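/- **Setting.** Let $\mathbb{D}_1^\infty=\{\zeta=(\zeta_1,\zeta_2,\dots)\in\ell^1:\ |\zeta_j|<1 \text{ for all } j\}$, a domain in the complex Banach space $\ell^1$. A function $F:\mathbb{D}_1^\infty\to\mathbb{C}$ is *analytic* if it is locally bounded and, for all $\zeta\in\mathbb{D}_1^\infty$ and $\eta\in\ell^1$, the function $z\mapsto F(\zeta+z\eta)$ is analytic on $\{z\in\mathbb{C}:\zeta+z\eta\in\mathbb{D}_1^\infty\}$. Let $m_\infty$ be the normalized Haar measure of the infinite torus $\mathbb{T}^\infty=\mathbb{T}\times\mathbb{T}\times\cdots$, and for $0<r<1$ and $w\in\mathbb{T}^\infty$ put $F_{[r]}(w)=F(rw_1,r^2w_2,r^3w_3,\dots)$. For $1\le p<\infty$, the Hardy space $\mathbf{H}^p_\infty$ is the normed space of all analytic $F$ on $\mathbb{D}_1^\infty$ with $$\|F\|_p^p=\sup_{0<r<1}\int_{\mathbb{T}^\infty}|F_{[r]}|^p\,\mathrm{d}m_\infty<\infty .$$ For an integer $n\ge1$ with prime factorization $n=p_1^{\alpha_1}\cdots p_k^{\alpha_k}$ ($p_j$ is the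 $j$-th prime) write $\zeta^{\alpha(n)}=\zeta_1^{\alpha_1}\cdots\zeta_k^{\alpha_k}$. Every analytic $F$ on $\mathbb{D}_1^\infty$ has a unique monomial expansion $F(\zeta)=\sum_{n=1}^\infty a_n\zeta^{\alpha(n)}$, absolutely convergent on $\mathbb{D}_1^\infty$. Given a sequence $X=\{X_n\}_{n\ge1}$ of random variables on a probability space $(\Omega,\mathcal{F},\mathbb{P})$, the randomization of $F$ is the random series $$(\mathcal{R}F)(\zeta)=\sum_{n=1}^\infty a_nX_n\zeta^{\alpha(n)} ,$$ and "$\mathcal{R}F\in\mathbf{H}^p_\infty$ a.s." means that, almost surely, this series converges absolutely at every point of $\mathbb{D}_1^\infty$ and its sum belongs to $\mathbf{H}^p_\infty$. The sequence $X$ is a *centered Gaussian process* if its members are real random variables, $(X_{n_1},\dots,X_{n_k})$ is a Gaussian random vector for all $k$ and $n_1,\dots,n_k$, and $\mathbb{E}X_n=0$ for all $n$; no independence is assumed. Finally, $L^2(\Omega,\mathbf{H}^p_\infty)$ is the space of (strongly measurable, a.s. equal ones identified) random vectors $Y:\Omega\to\mathbf{H}^p_\infty$ with $\|Y\|^2_{L^2(\Omega,\mathbf{H}^p_\infty)}=\int_\Omega\|Y\|_p^2\,\mathrm{d}\mathbb{P}<\infty$.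 **Theorem.** Let $1\le p<\infty$ and let $X=\{X_n\}_{n\ge1}$ be a centered Gaussian process. If for every $F\in\mathbf{H}^2_\infty$ one has $\mathcal{R}F\in\mathbf{H}^p_\infty$ a.s., then $\mathcal{R}$ defines a bounded linear operator from $\mathbf{H}^2_\infty$ to $L^2(\Omega,\mathbf{H}^p_\infty)$. -/

import Mathlib

open MeasureTheory ProbabilityTheory Topology Filter
open scoped ENNReal

namespace InfHardy

noncomputable section

/-! ## The domain, analytic functions, the infinite torus

Coordinates are indexed by `j : ℕ` starting at `0`, so that `ζ j` is the `(j+1)`-st variable. -/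

/-- The complex sequence space `ℓ¹`. -/
abbrev Ell1 : Type := lp (fun _ : ℕ => ℂ) 1

/-- The domain of all absolutely summable sequences whose entries lie in the open unit disk. -/
def polydisk : Set Ell1 := {ζ | ∀ j, ‖ζ j‖ < 1}

/-- Extension by zero of a function on the domain to the whole of `ℓ¹`; only its values on the
domain are used below. -/
def ext0 (F : polydisk → ℂ) : Ell1 → ℂ := Function.extend Subtype.val F 0

/-- `F` is analytic: it is locally bounded, and for every point `ζ` of the domain and every
`η ∈ ℓ¹` the function `z ↦ F (ζ + z η)` is analytic on the open set of all complex `z` for which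
`ζ + z η` lies in the domain. -/
structure IsAnalytic (F : polydisk → ℂ) : Prop where
  locallyBounded : ∀ ζ : polydisk, ∃ M : ℝ, ∀ᶠ ξ in 𝓝 ζ, ‖F ξ‖ ≤ M
  analytic_line : ∀ (ζ : polydisk) (η : Ell1),
    AnalyticOnNhd ℂ (fun z : ℂ => ext0 F ((ζ : Ell1) + z • η)) {z | (ζ : Ell1) + z • η ∈ polydisk}

/-- The Borel structure of the unit circle. -/
instance : MeasurableSpace Circle := borel Circle

instance : BorelSpace Circle := ⟨rfl⟩

/-- The infinite torus, a compact group with the product topology. -/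
abbrev Torus : Type := ℕ → Circle

/-- The Haar measure of the infinite torus, of total mass one. -/
def haarTorus : Measure Torus := Measure.haarMeasure ⊤

instance : haarTorus.IsHaarMeasure := by unfold haarTorus; infer_instance

instance : IsProbabilityMeasure haarTorus :=
  ⟨by simpa [haarTorus] using Measure.haarMeasure_self (K₀ := (⊤ : TopologicalSpace.PositiveCompacts Torus))⟩

lemma summable_dil (r : Set.Ioo (0 : ℝ) 1) : Summable fun j : ℕ => (r : ℝ) ^ (j + 1) :=
  (summable_nat_add_iff 1).2 (summable_geometric_of_lt_one r.2.1.le r.2.2)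

lemma norm_dil (r : Set.Ioo (0 : ℝ) 1) (w : Torus) (j : ℕ) :
    ‖((r : ℝ) : ℂ) ^ (j + 1) * (w j : ℂ)‖ = (r : ℝ) ^ (j + 1) := by
  rw [norm_mul, norm_pow, Circle.norm_coe, Complex.norm_real, Real.norm_of_nonneg r.2.1.le, mul_one]

/-- The point `(r w₁, r² w₂, r³ w₃, …)` of the domain. -/
def dilPoint (r : Set.Ioo (0 : ℝ) 1) (w : Torus) : polydisk :=
  ⟨⟨fun j => ((r : ℝ) : ℂ) ^ (j + 1) * (w j : ℂ), memℓp_gen (by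
      simpa only [norm_dil, ENNReal.toReal_one, Real.rpow_one] using summable_dil r)⟩, fun j => by
    change ‖((r : ℝ) : ℂ) ^ (j + 1) * (w j : ℂ)‖ < 1
    rw [norm_dil]
    exact pow_lt_one₀ r.2.1.le r.2.2 (by simp)⟩

/-- The dilation `F_[r] (w) = F (r w₁, r² w₂, r³ w₃, …)`, a function on the infinite torus. -/
def dilate (F : polydisk → ℂ) (r : Set.Ioo (0 : ℝ) 1) (w : Torus) : ℂ := F (dilPoint r w)

/-- The extended Hardy norm, the supremum over `0 < r < 1` of the `L^p` norms of `F_[r]`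
with respect to Haar measure. -/
def hardyENorm (p : ℝ≥0∞) (F : polydisk → ℂ) : ℝ≥0∞ :=
  ⨆ r : Set.Ioo (0 : ℝ) 1, eLpNorm (dilate F r) p haarTorus

/-! ## Facts needed to see that the Hardy spaces are normed spaces -/

lemma ext0_coe (F : polydisk → ℂ) (ζ : polydisk) : ext0 F ζ = F ζ :=
  Subtype.val_injective.extend_apply F 0 ζ

lemma ext0_of_mem (F : polydisk → ℂ) {ζ : Ell1} (h : ζ ∈ polydisk) : ext0 F ζ = F ⟨ζ, h⟩ :=
  ext0_coe F ⟨ζ, h⟩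

lemma ext0_add (F G : polydisk → ℂ) : ext0 (F + G) = ext0 F + ext0 G := by
  funext ζ
  by_cases h : ζ ∈ polydisk
  · simp [ext0_of_mem _ h]
  · have h' : ¬ ∃ a : polydisk, (a : Ell1) = ζ := by rintro ⟨a, rfl⟩; exact h a.2
    simp [ext0, Function.extend_apply' _ _ _ h']

lemma ext0_smul (c : ℂ) (F : polydisk → ℂ) : ext0 (c • F) = c • ext0 F := by
  funext ζ
  by_cases h : ζ ∈ polydisk
  · simp [ext0_of_mem _ h]
  · have h' : ¬ ∃ a : polydisk, (a : Ell1) = ζ := by rintro ⟨a, rfl⟩; exact h a.2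
    simp [ext0, Function.extend_apply' _ _ _ h']

lemma isAnalytic_zero : IsAnalytic 0 where
  locallyBounded _ := ⟨0, by simp⟩
  analytic_line ζ η := by
    have : ext0 (0 : polydisk → ℂ) = 0 := by simpa using ext0_smul 0 0
    rw [this]
    exact analyticOnNhd_const

lemma IsAnalytic.add {F G : polydisk → ℂ} (hF : IsAnalytic F) (hG : IsAnalytic G) :
    IsAnalytic (F + G) where
  locallyBounded ζ := by
    obtain ⟨M, hM⟩ := hF.locallyBounded ζ
    obtain ⟨N, hN⟩ := hG.locallyBounded ζ
    refine ⟨M + N, ?_⟩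
    filter_upwards [hM, hN] with ξ h1 h2
    exact (norm_add_le _ _).trans (add_le_add h1 h2)
  analytic_line ζ η := by
    rw [ext0_add]
    exact (hF.analytic_line ζ η).add (hG.analytic_line ζ η)

lemma IsAnalytic.smul {F : polydisk → ℂ} (c : ℂ) (hF : IsAnalytic F) : IsAnalytic (c • F) where
  locallyBounded ζ := by
    obtain ⟨M, hM⟩ := hF.locallyBounded ζ
    refine ⟨‖c‖ * M, ?_⟩
    filter_upwards [hM] with ξ h1
    rw [Pi.smul_apply, norm_smul]
    gcongr
  analytic_line ζ η := by
    rw [ext0_smul]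
    exact (analyticOnNhd_const (v := c)).smul (hF.analytic_line ζ η)

lemma isOpen_polydisk : IsOpen polydisk := by
  rw [Metric.isOpen_iff]
  intro ζ hζ
  have hs : Summable fun j => ‖ζ j‖ := by
    simpa using (lp.memℓp ζ).summable (by simp)
  have hfin : ∀ᶠ j in cofinite, ‖ζ j‖ < 1 / 2 :=
    hs.tendsto_cofinite_zero.eventually (gt_mem_nhds (by norm_num))
  obtain ⟨c, hc1, hc⟩ : ∃ c < (1 : ℝ), ∀ j, ‖ζ j‖ ≤ c := by
    have hfin' : {j | ¬ ‖ζ j‖ < 1 / 2}.Finite := hfin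
    obtain ⟨c, hc⟩ : ∃ c < (1 : ℝ), ∀ j ∈ hfin'.toFinset, ‖ζ j‖ ≤ c := by
      induction hfin'.toFinset using Finset.induction_on with
      | empty => exact ⟨0, by norm_num, by simp⟩
      | insert a s _ ih =>
        obtain ⟨c, hc1, hc⟩ := ih
        refine ⟨max c ‖ζ a‖, max_lt hc1 (hζ a), fun j hj => ?_⟩
        rcases Finset.mem_insert.1 hj with rfl | hj
        · exact le_max_right _ _
        · exact (hc j hj).trans (le_max_left _ _)
    refine ⟨max c (1 / 2), max_lt hc.1 (by norm_num), fun j => ?_⟩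
    by_cases h : ‖ζ j‖ < 1 / 2
    · exact h.le.trans (le_max_right _ _)
    · exact (hc.2 j (by simpa using h)).trans (le_max_left _ _)
  refine ⟨1 - c, by linarith, fun ξ hξ j => ?_⟩
  have h1 : ‖(ξ - ζ) j‖ ≤ ‖ξ - ζ‖ := lp.norm_apply_le_norm (by simp) _ j
  have h2 : ‖ξ - ζ‖ < 1 - c := by simpa [dist_eq_norm] using hξ
  have h3 : ξ j = (ξ - ζ) j + ζ j := by simp
  rw [h3]
  linarith [norm_add_le ((ξ - ζ) j) (ζ j), hc j]

lemma IsAnalytic.continuous {F : polydisk → ℂ} (hF : IsAnalytic F) : Continuous F := by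
  rw [continuous_iff_continuousAt]
  intro ζ
  obtain ⟨M, hM⟩ := hF.locallyBounded ζ
  obtain ⟨ρ, hρ, hb⟩ : ∃ ρ > 0, ∀ ξ : Ell1, dist ξ ζ < ρ → ∃ h : ξ ∈ polydisk, ‖F ⟨ξ, h⟩‖ ≤ M := by
    obtain ⟨ε, hε, h1⟩ := Metric.eventually_nhds_iff.1 hM
    obtain ⟨δ, hδ, h2⟩ := Metric.isOpen_iff.1 isOpen_polydisk ζ ζ.2
    refine ⟨min ε δ, lt_min hε hδ, fun ξ hξ => ?_⟩
    have hm : ξ ∈ polydisk := h2 (hξ.trans_le (min_le_right _ _))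
    exact ⟨hm, h1 (y := ⟨ξ, hm⟩) (hξ.trans_le (min_le_left _ _))⟩
  have key : ∀ ξ : polydisk, dist ξ ζ < ρ → dist (F ξ) (F ζ) ≤ 2 * M / ρ * dist ξ ζ := by
    intro ξ hξ
    by_cases hne : ξ = ζ
    · simp [hne]
    set h : Ell1 := (ξ : Ell1) - ζ with hh
    have hd : dist ξ ζ = ‖h‖ := by rw [Subtype.dist_eq, dist_eq_norm]
    have hpos : 0 < ‖h‖ := by rw [← hd]; exact dist_pos.2 hne
    have hball : ∀ z ∈ Metric.ball (0 : ℂ) (ρ / ‖h‖), dist ((ζ : Ell1) + z • h) ζ < ρ := by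
      intro z hz
      rw [dist_eq_norm, add_sub_cancel_left, norm_smul]
      rw [mem_ball_zero_iff, lt_div_iff₀ hpos] at hz
      exact hz
    have hdiff : DifferentiableOn ℂ (fun z : ℂ => ext0 F ((ζ : Ell1) + z • h))
        (Metric.ball 0 (ρ / ‖h‖)) :=
      (hF.analytic_line ζ h).differentiableOn.mono fun z hz => (hb _ (hball z hz)).1
    have hz0 : ext0 F ((ζ : Ell1) + (0 : ℂ) • h) = F ζ := by simp [ext0_coe]
    have hz1 : ext0 F ((ζ : Ell1) + (1 : ℂ) • h) = F ξ := by
      rw [one_smul, hh, add_sub_cancel, ext0_coe]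
    have hmaps : Set.MapsTo (fun z : ℂ => ext0 F ((ζ : Ell1) + z • h))
        (Metric.ball 0 (ρ / ‖h‖)) (Metric.closedBall (ext0 F ((ζ : Ell1) + (0 : ℂ) • h)) (2 * M)) := by
      intro z hz
      obtain ⟨hm, hle⟩ := hb _ (hball z hz)
      obtain ⟨_, hle0⟩ := hb ζ (by simpa using hρ)
      rw [mem_closedBall_iff_norm, hz0]
      simp only [ext0_of_mem F hm]
      have := norm_sub_le (F ⟨_, hm⟩) (F ζ)
      have h0 : ‖F ζ‖ ≤ M := hle0
      linarith
    have h1mem : (1 : ℂ) ∈ Metric.ball (0 : ℂ) (ρ / ‖h‖) := by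
      rw [mem_ball_zero_iff, lt_div_iff₀ hpos, norm_one, one_mul, ← hd]
      exact hξ
    have := Complex.dist_le_div_mul_dist_of_mapsTo_ball hdiff hmaps h1mem
    rw [hz0, hz1] at this
    refine this.trans (le_of_eq ?_)
    rw [hd]
    simp
    field_simp
  refine tendsto_iff_dist_tendsto_zero.2 ?_
  have hlim : Tendsto (fun ξ : polydisk => 2 * M / ρ * dist ξ ζ) (𝓝 ζ) (𝓝 0) := by
    have : Tendsto (fun ξ : polydisk => 2 * M / ρ * dist ξ ζ) (𝓝 ζ) (𝓝 (2 * M / ρ * dist ζ ζ)) :=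
      (Continuous.tendsto (by fun_prop) ζ)
    simpa using this
  refine squeeze_zero' (Eventually.of_forall fun _ => dist_nonneg) ?_ hlim
  filter_upwards [Metric.ball_mem_nhds ζ hρ] with ξ hξ
  exact key ξ hξ

lemma continuous_dilPoint (r : Set.Ioo (0 : ℝ) 1) : Continuous (dilPoint r) := by
  refine Continuous.subtype_mk (f := fun w => ((dilPoint r w : polydisk) : Ell1)) ?_ _
  have hs : ∀ w, ((dilPoint r w : polydisk) : Ell1) =
      ∑' j, lp.single 1 j (((r : ℝ) : ℂ) ^ (j + 1) * (w j : ℂ)) := fun w =>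
    (lp.hasSum_single (by simp) (dilPoint r w : Ell1)).tsum_eq.symm
  simp_rw [hs]
  refine continuous_tsum (fun j => ?_) (summable_dil r) fun j w => ?_
  · exact (lp.isometry_single (E := fun _ : ℕ => ℂ) (p := 1) j).continuous.comp (by fun_prop)
  · rw [lp.norm_single (by simp), norm_dil]

lemma IsAnalytic.continuous_dilate {F : polydisk → ℂ} (hF : IsAnalytic F)
    (r : Set.Ioo (0 : ℝ) 1) : Continuous (dilate F r) :=
  hF.continuous.comp (continuous_dilPoint r)

lemma IsAnalytic.aestronglyMeasurable_dilate {F : polydisk → ℂ} (hF : IsAnalytic F)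
    (r : Set.Ioo (0 : ℝ) 1) : AEStronglyMeasurable (dilate F r) haarTorus :=
  (hF.continuous_dilate r).aestronglyMeasurable

lemma hardyENorm_add_le {p : ℝ≥0∞} (hp : 1 ≤ p) {F G : polydisk → ℂ} (hF : IsAnalytic F)
    (hG : IsAnalytic G) : hardyENorm p (F + G) ≤ hardyENorm p F + hardyENorm p G :=
  iSup_le fun r => (eLpNorm_add_le (hF.aestronglyMeasurable_dilate r)
    (hG.aestronglyMeasurable_dilate r) hp).trans
      (add_le_add (le_iSup (fun r => eLpNorm (dilate F r) p haarTorus) r)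
        (le_iSup (fun r => eLpNorm (dilate G r) p haarTorus) r))

lemma hardyENorm_smul (p : ℝ≥0∞) (c : ℂ) (F : polydisk → ℂ) :
    hardyENorm p (c • F) = ‖c‖ₑ * hardyENorm p F := by
  rw [hardyENorm, hardyENorm, ENNReal.mul_iSup]
  exact iSup_congr fun r => eLpNorm_const_smul c (dilate F r) p haarTorus

/-- An analytic function that vanishes at all points `(r w₁, r² w₂, …)` vanishes identically. -/
lemma IsAnalytic.eq_zero_of_dilate {F : polydisk → ℂ} (hF : IsAnalytic F)
    (h0 : ∀ r w, dilate F r w = 0) : F = 0 := by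
  have main : ∀ (N : ℕ) (r : Set.Ioo (0 : ℝ) 1) (w : Torus) (ζ : polydisk),
      (∀ j, N ≤ j → (ζ : Ell1) j = ((r : ℝ) : ℂ) ^ (j + 1) * (w j : ℂ)) → F ζ = 0 := by
    intro N
    induction N with
    | zero =>
      intro r w ζ hζ
      have : ζ = dilPoint r w := Subtype.ext (lp.ext (funext fun j => hζ j (Nat.zero_le j)))
      rw [this]
      exact h0 r w
    | succ N ih =>
      intro r w ζ hζ
      set s : ℝ := (r : ℝ) ^ (N + 1) with hs
      have hs0 : 0 < s := pow_pos r.2.1 _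
      have hs1 : s < 1 := pow_lt_one₀ r.2.1.le r.2.2 (by simp)
      set e : Ell1 := lp.single 1 N (1 : ℂ) with he
      set c : ℂ := -(ζ : Ell1) N with hc
      have hcoord : ∀ (z : ℂ) (j : ℕ), ((ζ : Ell1) + z • e) j
          = if j = N then z - c else (ζ : Ell1) j := by
        intro z j
        have h1 : ((ζ : Ell1) + z • e) j = (ζ : Ell1) j + z * e j := rfl
        rw [h1]
        by_cases hj : j = N
        · subst hj
          rw [if_pos rfl, he, lp.single_apply_self, hc]
          ring
        · rw [if_neg hj, he, lp.single_apply_ne _ _ _ hj, mul_zero, add_zero]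
      have hdom : {z : ℂ | (ζ : Ell1) + z • e ∈ polydisk} = Metric.ball c 1 := by
        ext z
        rw [Set.mem_ofPred_eq, mem_ball_iff_norm]
        constructor
        · intro h; simpa [hcoord] using h N
        · intro h j
          rw [hcoord]
          split_ifs
          · exact h
          · exact ζ.2 j
      have han := hF.analytic_line ζ e
      rw [hdom] at han
      have hsph : Set.EqOn (fun z : ℂ => ext0 F ((ζ : Ell1) + z • e)) (fun _ => 0)
          (frontier (Metric.ball c s)) := by
        intro z hz
        rw [frontier_ball c hs0.ne', mem_sphere_iff_norm] at hz
        have hm : (ζ : Ell1) + z • e ∈ polydisk := by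
          have : z ∈ Metric.ball c 1 := by rw [mem_ball_iff_norm, hz]; exact hs1
          rw [← hdom] at this
          exact this
        change ext0 F ((ζ : Ell1) + z • e) = 0
        rw [ext0_of_mem F hm]
        have hu : ‖(z - c) / (s : ℂ)‖ = 1 := by
          rw [norm_div, hz, Complex.norm_real, Real.norm_of_nonneg hs0.le, div_self hs0.ne']
        obtain ⟨u, hu'⟩ : ∃ u : Circle, (u : ℂ) = (z - c) / (s : ℂ) :=
          ⟨⟨_, mem_sphere_zero_iff_norm.2 hu⟩, rfl⟩
        refine ih r (Function.update w N u) _ ?_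
        intro j hj
        change ((ζ : Ell1) + z • e) j = _
        rw [hcoord]
        by_cases hjN : j = N
        · subst hjN
          have hsc : ((r : ℝ) : ℂ) ^ (j + 1) = (s : ℂ) := by rw [hs]; push_cast; rfl
          have hs0' : (s : ℂ) ≠ 0 := by exact_mod_cast hs0.ne'
          rw [if_pos rfl, Function.update_self, hsc, hu']
          field_simp
        · rw [if_neg hjN, Function.update_of_ne hjN]
          exact hζ j (by omega)
      have hball : Set.EqOn (fun z : ℂ => ext0 F ((ζ : Ell1) + z • e)) (fun _ => 0)
          (Metric.ball c s) := by
        refine Complex.eqOn_of_eqOn_frontier Metric.isBounded_ball ?_ diffContOnCl_const hsph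
        refine DifferentiableOn.diffContOnCl ?_
        rw [closure_ball c hs0.ne']
        exact han.differentiableOn.mono (Metric.closedBall_subset_ball hs1)
      have hall := han.eqOn_zero_of_preconnected_of_eventuallyEq_zero
        (convex_ball c 1).isPreconnected (Metric.mem_ball_self one_pos)
        (hball.eventuallyEq_of_mem (Metric.ball_mem_nhds c hs0))
      have := hall (x := 0) (by
        rw [mem_ball_iff_norm, hc]; simpa using ζ.2 N)
      simpa [ext0_coe] using this
  funext ζ
  let r : Set.Ioo (0 : ℝ) 1 := ⟨1 / 2, by norm_num, by norm_num⟩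
  let d : Ell1 := (ζ : Ell1) - dilPoint r 1
  let q : ℕ → Ell1 := fun N => (dilPoint r 1 : Ell1) + ∑ j ∈ Finset.range N, lp.single 1 j (d j)
  have hq : Tendsto q atTop (𝓝 (ζ : Ell1)) := by
    have h1 := ((lp.hasSum_single (by simp) d).tendsto_sum_nat).const_add (dilPoint r 1 : Ell1)
    have h2 : (dilPoint r 1 : Ell1) + d = ζ := by simp [d]
    rwa [h2] at h1
  have hqc : ∀ N j, q N j = if j < N then (ζ : Ell1) j else (dilPoint r 1 : Ell1) j := by
    intro N j
    have h1 : (∑ i ∈ Finset.range N, lp.single 1 i (d i) : Ell1) j = if j < N then d j else 0 := by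
      rw [lp.coeFn_sum, Finset.sum_apply]
      by_cases hj : j < N
      · rw [if_pos hj, Finset.sum_eq_single_of_mem j (Finset.mem_range.2 hj)]
        · simp
        · intro i _ hi
          exact lp.single_apply_ne _ _ _ hi.symm
      · rw [if_neg hj]
        refine Finset.sum_eq_zero fun i hi => lp.single_apply_ne _ _ _ ?_
        rintro rfl
        exact hj (Finset.mem_range.1 hi)
    change (dilPoint r 1 : Ell1) j + (∑ i ∈ Finset.range N, lp.single 1 i (d i) : Ell1) j = _
    rw [h1]
    split_ifs
    · simp [d]
    · simp
  have hqm : ∀ N, q N ∈ polydisk := by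
    intro N j
    rw [hqc]
    split_ifs
    · exact ζ.2 j
    · exact (dilPoint r 1).2 j
  have hz : ∀ N, F ⟨q N, hqm N⟩ = 0 := fun N => main N r 1 _ fun j hj => by
    change q N j = _
    rw [hqc, if_neg (by omega)]
    rfl
  have hlim : Tendsto (fun N => F ⟨q N, hqm N⟩) atTop (𝓝 (F ζ)) :=
    (hF.continuous.tendsto ζ).comp (tendsto_subtype_rng.2 hq)
  simp_rw [hz] at hlim
  exact tendsto_nhds_unique hlim tendsto_const_nhds

lemma IsAnalytic.eq_zero_of_hardyENorm {p : ℝ≥0∞} (hp : 1 ≤ p) {F : polydisk → ℂ}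
    (hF : IsAnalytic F) (h : hardyENorm p F = 0) : F = 0 := by
  refine hF.eq_zero_of_dilate fun r w => ?_
  have h1 : eLpNorm (dilate F r) p haarTorus = 0 := by
    have := (ENNReal.iSup_eq_zero.1 h) r
    exact this
  rw [eLpNorm_eq_zero_iff (hF.aestronglyMeasurable_dilate r) (by positivity)] at h1
  have := (Continuous.ae_eq_iff_eq haarTorus (hF.continuous_dilate r) continuous_const
    (g := fun _ => (0 : ℂ))).1 h1
  exact congrFun this w

/-! ## The Hardy spaces -/

/-- The linear space of all analytic functions on the domain with finite Hardy norm. -/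
def hardySubmodule (p : ℝ≥0∞) [hp : Fact (1 ≤ p)] : Submodule ℂ (polydisk → ℂ) where
  carrier := {F | IsAnalytic F ∧ hardyENorm p F < ∞}
  zero_mem' := ⟨isAnalytic_zero, by
    have := hardyENorm_smul p 0 0
    simp only [smul_zero, enorm_zero, zero_mul] at this
    simp [this]⟩
  add_mem' := fun hF hG => ⟨hF.1.add hG.1,
    (hardyENorm_add_le hp.out hF.1 hG.1).trans_lt (ENNReal.add_lt_top.2 ⟨hF.2, hG.2⟩)⟩
  smul_mem' := fun c F hF => ⟨hF.1.smul c, by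
    rw [hardyENorm_smul]
    exact ENNReal.mul_lt_top (by simp) hF.2⟩

/-- The Hardy space of exponent `p` over the domain. It is a type of its own, so that its topology
is that of the Hardy norm, not that of pointwise convergence. -/
def Hardy (p : ℝ≥0∞) [Fact (1 ≤ p)] : Type := hardySubmodule p

variable (p : ℝ≥0∞) [hp : Fact (1 ≤ p)]

instance : AddCommGroup (Hardy p) := inferInstanceAs (AddCommGroup (hardySubmodule p))

instance : Module ℂ (Hardy p) := inferInstanceAs (Module ℂ (hardySubmodule p))

instance : CoeFun (Hardy p) (fun _ => polydisk → ℂ) := ⟨fun F => F.1⟩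

instance : Norm (Hardy p) := ⟨fun F => (hardyENorm p F).toReal⟩

lemma hardyCore : NormedSpace.Core ℂ (Hardy p) where
  norm_nonneg _ := ENNReal.toReal_nonneg
  norm_smul c F := by
    change (hardyENorm p (c • F.1)).toReal = ‖c‖ * (hardyENorm p F.1).toReal
    rw [hardyENorm_smul, ENNReal.toReal_mul, toReal_enorm]
  norm_triangle F G := by
    change (hardyENorm p (F.1 + G.1)).toReal ≤ (hardyENorm p F.1).toReal + (hardyENorm p G.1).toReal
    rw [← ENNReal.toReal_add F.2.2.ne G.2.2.ne]
    exact ENNReal.toReal_mono (ENNReal.add_ne_top.2 ⟨F.2.2.ne, G.2.2.ne⟩)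
      (hardyENorm_add_le hp.out F.2.1 G.2.1)
  norm_eq_zero_iff F := by
    constructor
    · intro h
      have h1 : hardyENorm p F.1 = 0 := (ENNReal.toReal_eq_zero_iff _).1 h |>.resolve_right F.2.2.ne
      exact Subtype.ext (F.2.1.eq_zero_of_hardyENorm hp.out h1)
    · rintro rfl
      have := hardyENorm_smul p 0 0
      simp only [smul_zero, enorm_zero, zero_mul] at this
      change (hardyENorm p 0).toReal = 0
      simp [this]

instance : NormedAddCommGroup (Hardy p) := NormedAddCommGroup.ofCore (hardyCore p)

instance : NormedSpace ℂ (Hardy p) := NormedSpace.ofCore (hardyCore p)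

/-! ## Monomial expansions -/

/-- The sequence of exponents `(α₁, α₂, …)` in the prime factorization of `n ≥ 1`, where the
`j`-th exponent is the multiplicity of the `j`-th prime. -/
def primeExponents (n : ℕ+) : ℕ →₀ ℕ :=
  (n : ℕ).factorization.comapDomain (Nat.nth Nat.Prime)
    (Nat.nth_injective Nat.infinite_setOfPred_prime).injOn

/-- The monomial of index `n`, that is, the product of the powers of the coordinates `ζ j`
with the exponents of `n`. -/
def monomial (n : ℕ+) (ζ : polydisk) : ℂ :=
  (primeExponents n).prod fun j k => (ζ : Ell1) j ^ k

/-- `F` is the sum of the (absolutely convergent) monomial series with coefficients `a`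
at every point of the domain. -/
def HasMonomialExpansion (F : polydisk → ℂ) (a : ℕ+ → ℂ) : Prop :=
  ∀ ζ : polydisk, HasSum (fun n => a n * monomial n ζ) (F ζ)

end

end InfHardy

open InfHardy

namespace InfHardy

noncomputable section

/-! ## Monomials -/

/-! The Hardy space of exponent two is ℓ² in disguise. Square-summable coefficients define an
analytic function because the monomials are absolutely summable, by an Euler product
(`sum_realMonomial_le`, `exists_hardy_two`). Conversely, the Fourier coefficients of the dilations
of `F` have the form `a n * r ^ deg n` and vanish at indices with a negative entry. Bessel's
inequality makes `a` square-summable, and the function built from `a` has the same Fourier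
coefficients as `F`, hence equals `F` (`exists_hasMonomialExpansion`). The hypothesis thus says that
for each single `a` in ℓ² the randomized coefficients almost surely have finite Hardy norm.

This improves to a bound in probability that is uniform on the unit ball of ℓ²
(`exists_uniform_bound`). Otherwise there are vectors `B k` of norm `2⁻ᵏ` whose randomizations
exceed `2ᵏ` with probability more than `1/4`. Attach independent unimodular factors to the `B k`:
every such sum lies in ℓ², so by Fubini its randomization is almost surely finite on the product
space. Flipping the sign of the `k`-th factor preserves the product measure and the difference of
the two sums isolates `B k`, so the randomizations of all `B k` are bounded in probability at once
(`exists_bound_of_signSum`), a contradiction.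

Gaussianity turns probability into moments: by Fernique's argument, if a centered Gaussian vector
has norm at most `a` with probability at least `3/4`, its second moment is at most a universal
multiple of `a²` (`lintegral_sq_le_gaussConst`). Only joint Gaussianity enters, not independence.
This bounds all polynomial randomizations (`exists_lintegral_partialSum_sq_le`). Lower
semicontinuity of the Hardy norm along partial sums and Fatou's lemma carry the bound to the limit;
applied to remainders, they also make a subsequence of polynomial randomizations converge almost
surely in norm, which gives strong measurability (`aestronglyMeasurable_randomization`). -/

lemma primeExponents_apply (n : ℕ+) (j : ℕ) :
    primeExponents n j = (n : ℕ).factorization (Nat.nth Nat.Prime j) := rfl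

lemma primeExponents_injective : Function.Injective primeExponents := by
  intro m n h
  refine PNat.coe_injective (Nat.eq_of_factorization_eq m.ne_zero n.ne_zero fun q => ?_)
  by_cases hq : q.Prime
  · have := DFunLike.congr_fun h (Nat.count Nat.Prime q)
    rwa [primeExponents_apply, primeExponents_apply, Nat.nth_count hq] at this
  · rw [Nat.factorization_eq_zero_of_not_prime _ hq, Nat.factorization_eq_zero_of_not_prime _ hq]

lemma primeExponents_surjective : Function.Surjective primeExponents := by
  intro α
  have hinj : Function.Injective (Nat.nth Nat.Prime) :=
    Nat.nth_injective Nat.infinite_setOfPred_prime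
  have hprime : ∀ q ∈ (α.mapDomain (Nat.nth Nat.Prime)).support, q.Prime := by
    intro q hq
    obtain ⟨j, -, rfl⟩ := Finset.mem_image.1 (Finsupp.mapDomain_support hq)
    exact Nat.prime_nth_prime j
  have hpos : 0 < (α.mapDomain (Nat.nth Nat.Prime)).prod (· ^ ·) :=
    Finset.prod_pos fun q hq => pow_pos (hprime q hq).pos _
  let n : ℕ+ := ⟨(α.mapDomain (Nat.nth Nat.Prime)).prod (· ^ ·), hpos⟩
  have hn : (n : ℕ) = (α.mapDomain (Nat.nth Nat.Prime)).prod (· ^ ·) := rfl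
  refine ⟨n, ?_⟩
  ext j
  rw [primeExponents_apply, hn, Nat.prod_pow_factorization_eq_self hprime,
    Finsupp.mapDomain_apply hinj]

/-- The product of the powers of the entries of a real sequence, with the exponents of `n`. -/
def realMonomial (n : ℕ+) (x : ℕ → ℝ) : ℝ := (primeExponents n).prod fun j k => x j ^ k

lemma norm_monomial (n : ℕ+) (ζ : polydisk) :
    ‖monomial n ζ‖ = realMonomial n fun j => ‖(ζ : Ell1) j‖ := by
  simp [monomial, realMonomial, Finsupp.prod, norm_prod, norm_pow]

lemma realMonomial_nonneg (n : ℕ+) {x : ℕ → ℝ} (hx : ∀ j, 0 ≤ x j) : 0 ≤ realMonomial n x :=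
  Finset.prod_nonneg fun j _ => pow_nonneg (hx j) _

lemma norm_monomial_le_one (n : ℕ+) (ζ : polydisk) : ‖monomial n ζ‖ ≤ 1 := by
  rw [norm_monomial]
  exact Finset.prod_le_one (fun j _ => pow_nonneg (norm_nonneg _) _)
    fun j _ => pow_le_one₀ (norm_nonneg _) (ζ.2 j).le

/-- Bounds one Euler factor by an exponential, so that the product over coordinates is controlled by
the ℓ¹ norm. -/
lemma inv_one_sub_le_exp {x c : ℝ} (hx : 0 ≤ x) (hxc : x ≤ c) (hc : c < 1) :
    (1 - x)⁻¹ ≤ Real.exp (x / (1 - c)) := by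
  have h1 : 0 < 1 - x := by linarith
  have h2 : 0 < 1 - c := by linarith
  calc (1 - x)⁻¹ = 1 + x / (1 - x) := by field_simp; ring
    _ ≤ 1 + x / (1 - c) := by gcongr
    _ ≤ _ := by rw [add_comm]; exact Real.add_one_le_exp _

/-- Partial sums of the Euler product of a summable sequence in `[0, c]`, with `c < 1`. -/
lemma sum_realMonomial_le {x : ℕ → ℝ} {c : ℝ} (hx : ∀ j, 0 ≤ x j) (hxc : ∀ j, x j ≤ c)
    (hc : c < 1) (hs : Summable x) (s : Finset ℕ+) :
    ∑ n ∈ s, realMonomial n x ≤ Real.exp ((∑' j, x j) / (1 - c)) := by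
  classical
  obtain ⟨N, hN⟩ : ∃ N, ∀ n ∈ s, (primeExponents n).support ⊆ Finset.range N := by
    refine ⟨(s.sup fun n => (primeExponents n).support).sup id + 1, fun n hn j hj => ?_⟩
    have : j ∈ s.sup fun n => (primeExponents n).support := Finset.mem_sup.2 ⟨n, hn, hj⟩
    exact Finset.mem_range.2 (Nat.lt_succ_of_le (Finset.le_sup (f := id) this))
  obtain ⟨K, hK⟩ : ∃ K, ∀ n ∈ s, ∀ j ∈ Finset.range N, primeExponents n j < K := by
    refine ⟨(s.sup fun n => (Finset.range N).sup (primeExponents n)) + 1, fun n hn j hj => ?_⟩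
    exact Nat.lt_succ_of_le ((Finset.le_sup (f := primeExponents n) hj).trans
      (Finset.le_sup (f := fun n => (Finset.range N).sup (primeExponents n)) hn))
  have hmon : ∀ n ∈ s, realMonomial n x = ∏ j : Fin N, x j ^ primeExponents n j := by
    intro n hn
    rw [realMonomial, Finsupp.prod_of_support_subset _ (hN n hn) _ (by simp),
      Finset.prod_range]
  let e : ℕ+ → Fin N → ℕ := fun n j => primeExponents n j
  have he : Set.InjOn e s := by
    intro m hm n hn h
    refine primeExponents_injective (Finsupp.ext fun j => ?_)
    by_cases hj : j < N
    · exact congrFun h ⟨j, hj⟩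
    · have hz : ∀ n ∈ s, primeExponents n j = 0 := fun n hn =>
        Finsupp.notMem_support_iff.1 fun h' => hj (Finset.mem_range.1 (hN n hn h'))
      rw [hz m hm, hz n hn]
  calc ∑ n ∈ s, realMonomial n x = ∑ α ∈ s.image e, ∏ j : Fin N, x j ^ α j := by
        rw [Finset.sum_image he]
        exact Finset.sum_congr rfl hmon
    -- Enlarging the index set to a full box of exponents makes the sum factor into truncated
    -- geometric series.
    _ ≤ ∑ α ∈ Fintype.piFinset fun _ : Fin N => Finset.range K, ∏ j : Fin N, x j ^ α j := by
        refine Finset.sum_le_sum_of_subset_of_nonneg ?_ fun α _ _ =>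
          Finset.prod_nonneg fun j _ => pow_nonneg (hx j) _
        intro α hα
        obtain ⟨n, hn, rfl⟩ := Finset.mem_image.1 hα
        exact Fintype.mem_piFinset.2 fun j =>
          Finset.mem_range.2 (hK n hn j (Finset.mem_range.2 j.2))
    _ = ∏ j : Fin N, ∑ k ∈ Finset.range K, x j ^ k := by
        rw [Finset.prod_univ_sum]
    _ ≤ ∏ j : Fin N, Real.exp (x j / (1 - c)) := by
        refine Finset.prod_le_prod (fun j _ => Finset.sum_nonneg fun k _ => pow_nonneg (hx j) _)
          fun j _ => ?_
        refine (Summable.sum_le_tsum _ (fun k _ => pow_nonneg (hx j) _)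
          (summable_geometric_of_lt_one (hx j) ((hxc j).trans_lt hc))).trans ?_
        rw [tsum_geometric_of_lt_one (hx j) ((hxc j).trans_lt hc)]
        exact inv_one_sub_le_exp (hx j) (hxc j) hc
    _ = Real.exp ((∑ j ∈ Finset.range N, x j) / (1 - c)) := by
        rw [← Real.exp_sum, Finset.sum_div, Finset.sum_range]
    _ ≤ _ := by
        have : 0 < 1 - c := by linarith
        gcongr
        exact hs.sum_le_tsum _ fun j _ => hx j

lemma summable_realMonomial {x : ℕ → ℝ} {c : ℝ} (hx : ∀ j, 0 ≤ x j) (hxc : ∀ j, x j ≤ c)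
    (hc : c < 1) (hs : Summable x) : Summable fun n => realMonomial n x :=
  summable_of_sum_le (fun n => realMonomial_nonneg n hx) (sum_realMonomial_le hx hxc hc hs)

lemma summable_norm_coord (ζ : Ell1) : Summable fun j => ‖ζ j‖ := by
  simpa using (lp.memℓp ζ).summable (by simp)

lemma norm_eq_tsum_coord (ζ : Ell1) : ‖ζ‖ = ∑' j, ‖ζ j‖ := by
  simpa using lp.norm_eq_tsum_rpow (p := 1) (by simp) ζ

/-- The coordinates of a point of the domain stay away from the unit circle, locally uniformly. -/
lemma exists_coord_le (ζ : polydisk) :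
    ∃ c < (1 : ℝ), ∃ ε > (0 : ℝ), ∀ j, ‖(ζ : Ell1) j‖ + ε ≤ c := by
  have hfin : ∀ᶠ j in cofinite, ‖(ζ : Ell1) j‖ < 1 / 2 :=
    (summable_norm_coord ζ).tendsto_cofinite_zero.eventually (gt_mem_nhds (by norm_num))
  have hfin' : {j | ¬ ‖(ζ : Ell1) j‖ < 1 / 2}.Finite := hfin
  obtain ⟨c, hc1, hc⟩ : ∃ c < (1 : ℝ), ∀ j ∈ hfin'.toFinset, ‖(ζ : Ell1) j‖ ≤ c := by
    induction hfin'.toFinset using Finset.induction_on with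
    | empty => exact ⟨0, by norm_num, by simp⟩
    | insert a s _ ih =>
      obtain ⟨c, hc1, hc⟩ := ih
      refine ⟨max c ‖(ζ : Ell1) a‖, max_lt hc1 (ζ.2 a), fun j hj => ?_⟩
      rcases Finset.mem_insert.1 hj with rfl | hj
      · exact le_max_right _ _
      · exact (hc j hj).trans (le_max_left _ _)
  have hb : ∀ j, ‖(ζ : Ell1) j‖ ≤ max c (1 / 2) := fun j => by
    by_cases h : ‖(ζ : Ell1) j‖ < 1 / 2
    · exact h.le.trans (le_max_right _ _)
    · exact (hc j (by simpa using h)).trans (le_max_left _ _)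
  have hm : max c (1 / 2) < 1 := max_lt hc1 (by norm_num)
  -- The gap between the supremum bound and `1` is halved: one half is the margin `ε`, the other
  -- remains between the new `c` and `1`.
  refine ⟨(max c (1 / 2) + 1) / 2, by linarith, (1 - max c (1 / 2)) / 2, by linarith, fun j => ?_⟩
  linarith [hb j]

lemma summable_norm_monomial (ζ : polydisk) : Summable fun n => ‖monomial n ζ‖ := by
  obtain ⟨c, hc, ε, hε, h⟩ := exists_coord_le ζ
  simp_rw [norm_monomial]
  exact summable_realMonomial (fun j => norm_nonneg _) (fun j => by linarith [h j]) hc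
    (summable_norm_coord ζ)

lemma summable_mul_monomial {a : ℕ+ → ℂ} {A : ℝ} (ha : ∀ n, ‖a n‖ ≤ A) (ζ : polydisk) :
    Summable fun n => a n * monomial n ζ := by
  refine Summable.of_norm_bounded ((summable_norm_monomial ζ).mul_left A) fun n => ?_
  rw [norm_mul]
  exact mul_le_mul_of_nonneg_right (ha n) (norm_nonneg _)

/-- The sum of the monomial series with coefficients `a`. -/
def monomialSum (a : ℕ+ → ℂ) (ζ : polydisk) : ℂ := ∑' n, a n * monomial n ζ

lemma hasMonomialExpansion_monomialSum {a : ℕ+ → ℂ} {A : ℝ} (ha : ∀ n, ‖a n‖ ≤ A) :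
    HasMonomialExpansion (monomialSum a) a := fun ζ => (summable_mul_monomial ha ζ).hasSum

/-- The Euler product bound depends only on the ℓ¹ norm and on the distance of the coordinates from
the unit circle, both of which are controlled on small balls. Along a line the series is a sum of
polynomials in `z` with a summable majorant near each point. -/
lemma isAnalytic_monomialSum {a : ℕ+ → ℂ} {A : ℝ} (ha : ∀ n, ‖a n‖ ≤ A) :
    IsAnalytic (monomialSum a) where
  locallyBounded ζ := by
    obtain ⟨c, hc, ε, hε, h⟩ := exists_coord_le ζ
    refine ⟨A * Real.exp ((‖(ζ : Ell1)‖ + ε) / (1 - c)), ?_⟩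
    filter_upwards [Metric.ball_mem_nhds ζ hε] with ξ hξ
    have hd : ‖(ξ : Ell1) - ζ‖ < ε := by
      rwa [Metric.mem_ball, Subtype.dist_eq, dist_eq_norm] at hξ
    have hA : 0 ≤ A := (norm_nonneg _).trans (ha 1)
    have hc' : 0 < 1 - c := by linarith
    have hcoord : ∀ j, ‖(ξ : Ell1) j‖ ≤ c := fun j => by
      have h1 : ‖((ξ : Ell1) - ζ) j‖ ≤ ‖(ξ : Ell1) - ζ‖ := lp.norm_apply_le_norm (by simp) _ j
      have h3 : (ξ : Ell1) j = ((ξ : Ell1) - ζ) j + (ζ : Ell1) j := by simp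
      rw [h3]
      linarith [norm_add_le (((ξ : Ell1) - ζ) j) ((ζ : Ell1) j), h j]
    have hnorm : ‖(ξ : Ell1)‖ ≤ ‖(ζ : Ell1)‖ + ε := by
      have := norm_add_le ((ξ : Ell1) - ζ) (ζ : Ell1)
      rw [sub_add_cancel] at this
      linarith
    have hsum : HasSum (fun n => A * ‖monomial n ξ‖) (A * ∑' n, ‖monomial n ξ‖) :=
      (summable_norm_monomial ξ).hasSum.mul_left A
    refine (tsum_of_norm_bounded hsum fun n => ?_).trans ?_
    · rw [norm_mul]
      exact mul_le_mul_of_nonneg_right (ha n) (norm_nonneg _)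
    · gcongr
      refine (Summable.tsum_le_of_sum_le (summable_norm_monomial ξ) fun s => ?_)
      simp_rw [norm_monomial]
      refine (sum_realMonomial_le (fun j => norm_nonneg _) hcoord hc
        (summable_norm_coord ξ) s).trans ?_
      rw [← norm_eq_tsum_coord]
      gcongr
  analytic_line ζ η := by
    have hopen : IsOpen {z : ℂ | (ζ : Ell1) + z • η ∈ polydisk} :=
      isOpen_polydisk.preimage (by fun_prop)
    refine DifferentiableOn.analyticOnNhd (fun z₀ hz₀ => ?_) hopen
    obtain ⟨c, hc, ε, hε, h⟩ := exists_coord_le ⟨_, hz₀⟩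
    -- Moving `z` by less than `δ` moves each coordinate by at most `ε`; the `+ 1` covers `η = 0`.
    set δ : ℝ := ε / (‖η‖ + 1) with hδ
    have hη : 0 < ‖η‖ + 1 := by positivity
    have hδ0 : 0 < δ := by positivity
    set x : ℕ → ℝ := fun j => ‖((ζ : Ell1) + z₀ • η) j‖ + δ * ‖η j‖ with hx
    have hxc : ∀ j, x j ≤ c := fun j => by
      have h1 : ‖η j‖ ≤ ‖η‖ + 1 := (lp.norm_apply_le_norm (by simp) η j).trans (by linarith)
      have h2 : δ * ‖η j‖ ≤ ε := by
        rw [hδ, div_mul_eq_mul_div, div_le_iff₀ hη]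
        gcongr
      linarith [h j]
    have hx0 : ∀ j, 0 ≤ x j := fun j => by positivity
    have hxs : Summable x := (summable_norm_coord _).add ((summable_norm_coord η).mul_left δ)
    have hbd : ∀ z ∈ Metric.ball z₀ δ, ∀ j, ‖(ζ : Ell1) j + z * η j‖ ≤ x j := by
      intro z hz j
      rw [mem_ball_iff_norm] at hz
      have h1 : (ζ : Ell1) j + z * η j = ((ζ : Ell1) + z₀ • η) j + (z - z₀) * η j := by
        change _ = ((ζ : Ell1) j + z₀ * η j) + _
        ring
      rw [h1]
      refine (norm_add_le _ _).trans ?_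
      rw [norm_mul]
      exact add_le_add le_rfl (mul_le_mul_of_nonneg_right hz.le (norm_nonneg _))
    have hmem : ∀ z ∈ Metric.ball z₀ δ, (ζ : Ell1) + z • η ∈ polydisk := fun z hz j =>
      ((hbd z hz j).trans (hxc j)).trans_lt hc
    have hdiff : DifferentiableOn ℂ (fun z : ℂ => ∑' n, a n *
        (primeExponents n).prod fun j k => ((ζ : Ell1) j + z * η j) ^ k) (Metric.ball z₀ δ) := by
      refine Complex.differentiableOn_tsum_of_summable_norm
        ((summable_realMonomial hx0 hxc hc hxs).mul_left A) (fun n => ?_) Metric.isOpen_ball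
        fun n z hz => ?_
      · simp only [Finsupp.prod]
        fun_prop
      · rw [norm_mul, Finsupp.prod, norm_prod]
        refine mul_le_mul (ha n) ?_ (by positivity) ((norm_nonneg _).trans (ha n))
        refine Finset.prod_le_prod (fun j _ => norm_nonneg _) fun j _ => ?_
        rw [norm_pow]
        exact pow_le_pow_left₀ (norm_nonneg _) (hbd z hz j) _
    refine ((hdiff.congr fun z hz => ?_).differentiableAt
      (Metric.ball_mem_nhds z₀ hδ0)).differentiableWithinAt
    rw [ext0_of_mem _ (hmem z hz)]
    rfl

lemma HasMonomialExpansion.eq_monomialSum {F : polydisk → ℂ} {a : ℕ+ → ℂ}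
    (h : HasMonomialExpansion F a) : F = monomialSum a :=
  funext fun ζ => (h ζ).tsum_eq.symm

lemma HasMonomialExpansion.unique {F G : polydisk → ℂ} {a : ℕ+ → ℂ}
    (hF : HasMonomialExpansion F a) (hG : HasMonomialExpansion G a) : F = G :=
  hF.eq_monomialSum.trans hG.eq_monomialSum.symm

lemma HasMonomialExpansion.add {F G : polydisk → ℂ} {a b : ℕ+ → ℂ}
    (hF : HasMonomialExpansion F a) (hG : HasMonomialExpansion G b) :
    HasMonomialExpansion (F + G) (a + b) := fun ζ => by
  simpa [add_mul] using (hF ζ).add (hG ζ)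

lemma HasMonomialExpansion.smul {F : polydisk → ℂ} {a : ℕ+ → ℂ} (c : ℂ)
    (hF : HasMonomialExpansion F a) : HasMonomialExpansion (c • F) (c • a) := fun ζ => by
  simpa [mul_assoc] using (hF ζ).mul_left c

/-! ## Characters of the infinite torus -/

/-- The character of the infinite torus with exponents `α`. -/
def chi (α : ℕ →₀ ℤ) (w : Torus) : Circle := α.prod fun j k => w j ^ k

lemma chi_mul (α : ℕ →₀ ℤ) (w v : Torus) : chi α (w * v) = chi α w * chi α v := by
  simp [chi, Finsupp.prod, mul_zpow, Finset.prod_mul_distrib]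

lemma chi_zero (w : Torus) : chi 0 w = 1 := Finsupp.prod_zero_index

lemma chi_add (α β : ℕ →₀ ℤ) (w : Torus) : chi (α + β) w = chi α w * chi β w :=
  Finsupp.prod_add_index' (fun _ => zpow_zero _) fun _ _ _ => zpow_add _ _ _

lemma chi_neg (α : ℕ →₀ ℤ) (w : Torus) : chi (-α) w = (chi α w)⁻¹ :=
  eq_inv_of_mul_eq_one_left (by rw [← chi_add, neg_add_cancel, chi_zero])

lemma chi_mulSingle (α : ℕ →₀ ℤ) (j : ℕ) (u : Circle) : chi α (Pi.mulSingle j u) = u ^ α j := by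
  rw [chi, Finsupp.prod, Finset.prod_eq_single j]
  · rw [Pi.mulSingle_eq_same]
  · intro i _ hi
    rw [Pi.mulSingle_eq_of_ne hi, one_zpow]
  · intro h
    rw [Finsupp.notMem_support_iff.1 h, zpow_zero]

lemma chi_single (j : ℕ) (w : Torus) : chi (Finsupp.single j 1) w = w j := by
  rw [chi, Finsupp.prod_single_index (zpow_zero _), zpow_one]

lemma continuous_chi (α : ℕ →₀ ℤ) : Continuous (chi α) :=
  continuous_finsetProd _ fun j _ => (continuous_apply j).zpow _

/-- The characters as complex-valued continuous functions. -/
def chiMap (α : ℕ →₀ ℤ) : C(Torus, ℂ) :=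
  ⟨fun w => (chi α w : ℂ), continuous_subtype_val.comp (continuous_chi α)⟩

lemma chiMap_apply (α : ℕ →₀ ℤ) (w : Torus) : chiMap α w = (chi α w : ℂ) := rfl

lemma conj_chiMap (α : ℕ →₀ ℤ) (w : Torus) :
    (starRingEnd ℂ) (chiMap α w) = chiMap (-α) w := by
  rw [chiMap_apply, chiMap_apply, chi_neg, Circle.coe_inv_eq_conj]

lemma chiMap_add (α β : ℕ →₀ ℤ) : chiMap (α + β) = chiMap α * chiMap β := by
  ext w
  simp [chiMap_apply, chi_add]

/-- A nontrivial character takes the value `-1` somewhere; translation by such a point shows that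
its integral equals its own negative. -/
lemma integral_chiMap (α : ℕ →₀ ℤ) : ∫ w, chiMap α w ∂haarTorus = if α = 0 then 1 else 0 := by
  split_ifs with h
  · simp [h, chiMap_apply, chi_zero]
  · obtain ⟨j, hj⟩ := DFunLike.ne_iff.1 h
    have hj' : (α j : ℝ) ≠ 0 := by exact_mod_cast hj
    set v : Torus := Pi.mulSingle j (Circle.exp (Real.pi / α j)) with hv
    have hchi : (chi α v : ℂ) = -1 := by
      rw [hv, chi_mulSingle, ← Circle.exp_intCast_mul, mul_div_cancel₀ _ hj', Circle.coe_exp]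
      exact Complex.exp_pi_mul_I
    have h1 : ∫ w, chiMap α (v * w) ∂haarTorus = ∫ w, chiMap α w ∂haarTorus :=
      integral_mul_left_eq_self (μ := haarTorus) (chiMap α) v
    simp_rw [chiMap_apply, chi_mul, Circle.coe_mul, hchi, integral_const_mul] at h1
    simp_rw [chiMap_apply]
    linear_combination (-1 / 2 : ℂ) * h1

/-- The characters as elements of `L²`. -/
def chiL2 (α : ℕ →₀ ℤ) : Lp ℂ 2 haarTorus := ContinuousMap.toLp 2 haarTorus ℂ (chiMap α)

lemma inner_chiL2 (α : ℕ →₀ ℤ) (f : C(Torus, ℂ)) :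
    inner ℂ (chiL2 α) (ContinuousMap.toLp 2 haarTorus ℂ f)
      = ∫ w, f w * chiMap (-α) w ∂haarTorus := by
  rw [chiL2, ContinuousMap.inner_toLp]
  simp_rw [conj_chiMap]

lemma orthonormal_chiL2 : Orthonormal ℂ chiL2 := by
  rw [orthonormal_iff_ite]
  intro α β
  change inner ℂ (chiL2 α) (ContinuousMap.toLp 2 haarTorus ℂ (chiMap β)) = _
  rw [inner_chiL2]
  have : ∀ w, chiMap β w * chiMap (-α) w = chiMap (β + -α) w := fun w => by
    rw [chiMap_add]; rfl
  simp_rw [this, integral_chiMap, ← sub_eq_add_neg, sub_eq_zero, eq_comm]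

/-- The star subalgebra of the continuous functions generated by the characters. -/
def chiSubalgebra : StarSubalgebra ℂ C(Torus, ℂ) where
  toSubalgebra := Algebra.adjoin ℂ (Set.range chiMap)
  star_mem' := by
    change Algebra.adjoin ℂ (Set.range chiMap) ≤ star (Algebra.adjoin ℂ (Set.range chiMap))
    refine Algebra.adjoin_le ?_
    rintro _ ⟨α, rfl⟩
    refine Algebra.subset_adjoin ⟨-α, ?_⟩
    ext w
    exact (conj_chiMap α w).symm

/-- Characters are closed under products, so the algebra they generate is just their linear span. -/
lemma chiSubalgebra_coe :
    chiSubalgebra.toSubalgebra.toSubmodule = Submodule.span ℂ (Set.range chiMap) := by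
  apply Algebra.adjoin_eq_span_of_subset
  refine .trans (fun x => Submonoid.closure_induction (fun _ => id) ⟨0, ?_⟩ ?_)
    Submodule.subset_span
  · ext w
    simp [chiMap_apply, chi_zero]
  · rintro _ _ _ _ ⟨α, rfl⟩ ⟨β, rfl⟩
    exact ⟨α + β, chiMap_add α β⟩

/-- Stone–Weierstrass: the coordinate functions are characters and separate points. -/
lemma chiSubalgebra_topologicalClosure : chiSubalgebra.topologicalClosure = ⊤ := by
  refine ContinuousMap.starSubalgebra_topologicalClosure_eq_top_of_separatesPoints _ ?_
  intro x y hxy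
  obtain ⟨j, hj⟩ := Function.ne_iff.1 hxy
  refine ⟨_, ⟨chiMap (Finsupp.single j 1), Algebra.subset_adjoin ⟨_, rfl⟩, rfl⟩, ?_⟩
  change chiMap _ x ≠ chiMap _ y
  rw [chiMap_apply, chiMap_apply, chi_single, chi_single]
  exact fun h => hj (Circle.ext h)

/-- A continuous function on the infinite torus all of whose Fourier coefficients vanish is zero. -/
lemma eq_zero_of_fourier {f : C(Torus, ℂ)}
    (h : ∀ α, ∫ w, f w * chiMap (-α) w ∂haarTorus = 0) : f = 0 := by
  let T : C(Torus, ℂ) →L[ℂ] Lp ℂ 2 haarTorus := ContinuousMap.toLp 2 haarTorus ℂ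
  have hmem : ∀ g : C(Torus, ℂ), inner ℂ (T f) (T g) = 0 := by
    have hcl : IsClosed {g : C(Torus, ℂ) | inner ℂ (T f) (T g) = 0} :=
      isClosed_eq (by fun_prop) continuous_const
    have hsub : (chiSubalgebra : Set C(Torus, ℂ)) ⊆ {g | inner ℂ (T f) (T g) = 0} := by
      intro g hg
      have hg' : g ∈ Submodule.span ℂ (Set.range chiMap) := by
        rw [← chiSubalgebra_coe]
        exact hg
      clear hg
      induction hg' using Submodule.span_induction with
      | mem g hg =>
        obtain ⟨α, rfl⟩ := hg
        have := inner_chiL2 α f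
        rw [h] at this
        exact inner_eq_zero_symm.1 this
      | zero => simp
      | add x y hx hy h1 h2 =>
        have h1' : inner ℂ (T f) (T x) = 0 := h1
        have h2' : inner ℂ (T f) (T y) = 0 := h2
        change inner ℂ (T f) (T (x + y)) = 0
        rw [map_add, inner_add_right, h1', h2', add_zero]
      | smul c x hx h1 =>
        have h1' : inner ℂ (T f) (T x) = 0 := h1
        change inner ℂ (T f) (T (c • x)) = 0
        rw [map_smul, inner_smul_right, h1', mul_zero]
    intro g
    have hg : g ∈ chiSubalgebra.topologicalClosure := by
      rw [chiSubalgebra_topologicalClosure]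
      trivial
    exact closure_minimal hsub hcl hg
  -- Orthogonality to every continuous function includes orthogonality to `f` itself; Haar measure
  -- charges open sets, so a continuous function that is zero in `L²` is zero.
  have hT : T f = 0 := inner_self_eq_zero.1 (hmem f)
  exact ContinuousMap.toLp_injective haarTorus (𝕜 := ℂ) (p := 2) (hT.trans (map_zero T).symm)

/-! ## Monomials on the torus -/

/-- The exponents of `n` as integers. -/
def intExponents (n : ℕ+) : ℕ →₀ ℤ := (primeExponents n).mapRange Nat.cast Nat.cast_zero

lemma intExponents_injective : Function.Injective intExponents := fun _ _ h =>
  primeExponents_injective (Finsupp.mapRange_injective _ Nat.cast_zero Nat.cast_injective h)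

lemma exists_intExponents_eq {α : ℕ →₀ ℤ} (h : ∀ j, 0 ≤ α j) : ∃ n, intExponents n = α := by
  obtain ⟨n, hn⟩ := primeExponents_surjective (α.mapRange Int.toNat Int.toNat_zero)
  refine ⟨n, Finsupp.ext fun j => ?_⟩
  rw [intExponents, hn, Finsupp.mapRange_apply, Finsupp.mapRange_apply, Int.toNat_of_nonneg (h j)]

lemma norm_coe_mul (w : Torus) (ζ : ℕ → ℂ) (j : ℕ) : ‖(w j : ℂ) * ζ j‖ = ‖ζ j‖ := by
  rw [norm_mul, Circle.norm_coe, one_mul]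

/-- The action of the torus on the domain by coordinatewise rotation. -/
def rot (w : Torus) (ζ : polydisk) : polydisk :=
  ⟨⟨fun j => (w j : ℂ) * (ζ : Ell1) j, memℓp_gen (by
      simpa only [norm_coe_mul, ENNReal.toReal_one, Real.rpow_one] using summable_norm_coord ζ)⟩, fun j => by
    change ‖(w j : ℂ) * (ζ : Ell1) j‖ < 1
    rw [norm_coe_mul]
    exact ζ.2 j⟩

lemma rot_apply (w : Torus) (ζ : polydisk) (j : ℕ) :
    (rot w ζ : Ell1) j = (w j : ℂ) * (ζ : Ell1) j := rfl

lemma dilPoint_eq_rot (r : Set.Ioo (0 : ℝ) 1) (w : Torus) : dilPoint r w = rot w (dilPoint r 1) :=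
  Subtype.ext (lp.ext (funext fun j => by
    change ((r : ℝ) : ℂ) ^ (j + 1) * (w j : ℂ) = (w j : ℂ) * (((r : ℝ) : ℂ) ^ (j + 1) * ((1 : Circle) : ℂ))
    rw [Circle.coe_one]
    ring))

lemma continuous_rot (ζ : polydisk) : Continuous fun w => rot w ζ := by
  refine Continuous.subtype_mk (f := fun w => ((rot w ζ : polydisk) : Ell1)) ?_ _
  have hs : ∀ w, ((rot w ζ : polydisk) : Ell1) =
      ∑' j, lp.single 1 j ((w j : ℂ) * (ζ : Ell1) j) := fun w =>
    (lp.hasSum_single (by simp) (rot w ζ : Ell1)).tsum_eq.symm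
  simp_rw [hs]
  refine continuous_tsum (fun j => ?_) (summable_norm_coord ζ) fun j w => ?_
  · exact (lp.isometry_single (E := fun _ : ℕ => ℂ) (p := 1) j).continuous.comp (by fun_prop)
  · rw [lp.norm_single (by simp), norm_coe_mul]

lemma monomial_rot (n : ℕ+) (w : Torus) (ζ : polydisk) :
    monomial n (rot w ζ) = monomial n ζ * chiMap (intExponents n) w := by
  rw [chiMap_apply, chi, intExponents, Finsupp.prod_mapRange_index (fun _ => zpow_zero _)]
  simp only [monomial, Finsupp.prod, rot_apply, mul_pow, Finset.prod_mul_distrib, zpow_natCast]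
  rw [mul_comm]
  congr 1
  exact (map_prod Circle.coeHom (fun j => w j ^ primeExponents n j) _).symm

/-- The degree of the monomial of index `n` in the dilation parameter. -/
def deg (n : ℕ+) : ℕ := (primeExponents n).sum fun j k => (j + 1) * k

lemma monomial_dilPoint_one (n : ℕ+) (r : Set.Ioo (0 : ℝ) 1) :
    monomial n (dilPoint r 1) = (((r : ℝ) ^ deg n : ℝ) : ℂ) := by
  have h : ∀ j, (dilPoint r 1 : Ell1) j = ((r : ℝ) : ℂ) ^ (j + 1) := fun j => by
    change ((r : ℝ) : ℂ) ^ (j + 1) * ((1 : Circle) : ℂ) = _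
    rw [Circle.coe_one, mul_one]
  simp only [monomial, deg, Finsupp.prod, Finsupp.sum, h]
  push_cast
  rw [← Finset.prod_pow_eq_pow_sum]
  simp_rw [pow_mul]

lemma monomial_dilPoint (n : ℕ+) (r : Set.Ioo (0 : ℝ) 1) (w : Torus) :
    monomial n (dilPoint r w) = (((r : ℝ) ^ deg n : ℝ) : ℂ) * chiMap (intExponents n) w := by
  rw [dilPoint_eq_rot, monomial_rot, monomial_dilPoint_one]

/-! ### Series of characters and their Fourier coefficients -/

lemma norm_chiMap_le (α : ℕ →₀ ℤ) : ‖chiMap α‖ ≤ 1 :=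
  (ContinuousMap.norm_le _ zero_le_one).2 fun w => by rw [chiMap_apply, Circle.norm_coe]

/-- The dilation of an analytic function as a continuous function on the torus. -/
def IsAnalytic.dilateMap {F : polydisk → ℂ} (hF : IsAnalytic F) (r : Set.Ioo (0 : ℝ) 1) :
    C(Torus, ℂ) := ⟨dilate F r, hF.continuous_dilate r⟩

/-- An absolutely convergent series of characters converges uniformly. -/
lemma hasSum_chiMap {ι : Type*} {c : ι → ℂ} {e : ι → ℕ →₀ ℤ} {f : C(Torus, ℂ)}
    (hc : Summable fun i => ‖c i‖) (h : ∀ w, HasSum (fun i => c i * chiMap (e i) w) (f w)) :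
    HasSum (fun i => c i • chiMap (e i)) f := by
  have hs : Summable fun i => c i • chiMap (e i) := by
    refine Summable.of_norm_bounded hc fun n => ?_
    rw [norm_smul]
    exact mul_le_of_le_one_right (norm_nonneg _) (norm_chiMap_le _)
  have heq : ∑' i, c i • chiMap (e i) = f := by
    ext w
    exact (ContinuousMap.hasSum_apply hs.hasSum w).unique (h w)
  exact heq ▸ hs.hasSum

/-- The Fourier coefficients of the sum of a uniformly convergent series of characters. -/
lemma hasSum_fourier {ι : Type*} {c : ι → ℂ} {e : ι → ℕ →₀ ℤ} {f : C(Torus, ℂ)}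
    (h : HasSum (fun i => c i • chiMap (e i)) f) (α : ℕ →₀ ℤ) :
    HasSum (fun i => c i * if α = e i then 1 else 0) (∫ w, f w * chiMap (-α) w ∂haarTorus) := by
  have h1 := (h.mapL (ContinuousMap.toLp 2 haarTorus ℂ)).mapL (innerSL ℂ (chiL2 α))
  rw [← inner_chiL2]
  convert! h1 using 2 with i
  rw [map_smul, map_smul, innerSL_apply_apply, smul_eq_mul]
  change _ = _ * inner ℂ (chiL2 α) (chiL2 (e i))
  rw [orthonormal_iff_ite.1 orthonormal_chiL2]

lemma integral_mul_chiMap_of_mem {ι : Type*} {c : ι → ℂ} {e : ι → ℕ →₀ ℤ} {f : C(Torus, ℂ)}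
    (h : HasSum (fun i => c i • chiMap (e i)) f) (he : Function.Injective e) (i : ι) :
    ∫ w, f w * chiMap (-e i) w ∂haarTorus = c i := by
  classical
  refine (hasSum_fourier h (e i)).unique ?_
  have : (fun j => c j * if e i = e j then (1 : ℂ) else 0) = fun j => if j = i then c i else 0 := by
    funext j
    by_cases hj : j = i
    · simp [hj]
    · simp [hj, he.ne (Ne.symm hj)]
  rw [this]
  exact hasSum_ite_eq i _

lemma integral_mul_chiMap_of_notMem {ι : Type*} {c : ι → ℂ} {e : ι → ℕ →₀ ℤ} {f : C(Torus, ℂ)}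
    (h : HasSum (fun i => c i • chiMap (e i)) f) {α : ℕ →₀ ℤ} (hα : ∀ i, α ≠ e i) :
    ∫ w, f w * chiMap (-α) w ∂haarTorus = 0 := by
  refine (hasSum_fourier h α).unique ?_
  simp [hα]

lemma HasMonomialExpansion.hasSum_dilateMap {F : polydisk → ℂ} {a : ℕ+ → ℂ}
    (h : HasMonomialExpansion F a) (hF : IsAnalytic F) (r : Set.Ioo (0 : ℝ) 1) :
    HasSum (fun n => (a n * (((r : ℝ) ^ deg n : ℝ) : ℂ)) • chiMap (intExponents n))
      (hF.dilateMap r) := by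
  refine hasSum_chiMap ?_ fun w => ?_
  · simpa only [monomial_dilPoint_one] using (h (dilPoint r 1)).summable.norm
  · have := h (dilPoint r w)
    simp_rw [monomial_dilPoint, ← mul_assoc] at this
    exact this

lemma HasMonomialExpansion.fourier_dilateMap {F : polydisk → ℂ} {a : ℕ+ → ℂ}
    (h : HasMonomialExpansion F a) (hF : IsAnalytic F) (r : Set.Ioo (0 : ℝ) 1) (n : ℕ+) :
    ∫ w, hF.dilateMap r w * chiMap (-intExponents n) w ∂haarTorus
      = a n * (((r : ℝ) ^ deg n : ℝ) : ℂ) :=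
  integral_mul_chiMap_of_mem (h.hasSum_dilateMap hF r) intExponents_injective n

lemma HasMonomialExpansion.coeff_unique {F : polydisk → ℂ} {a b : ℕ+ → ℂ}
    (hF : IsAnalytic F) (ha : HasMonomialExpansion F a) (hb : HasMonomialExpansion F b) :
    a = b := by
  funext n
  let r : Set.Ioo (0 : ℝ) 1 := ⟨1 / 2, by norm_num, by norm_num⟩
  have h := (ha.fourier_dilateMap hF r n).symm.trans (hb.fourier_dilateMap hF r n)
  refine mul_right_cancel₀ ?_ h
  exact_mod_cast (pow_pos r.2.1 _).ne'

lemma enorm_toLp_dilateMap (p : ℝ≥0∞) [Fact (1 ≤ p)] {F : polydisk → ℂ} (hF : IsAnalytic F)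
    (r : Set.Ioo (0 : ℝ) 1) :
    ‖ContinuousMap.toLp p haarTorus ℂ (hF.dilateMap r)‖ₑ = eLpNorm (dilate F r) p haarTorus := by
  rw [Lp.enorm_def]
  exact eLpNorm_congr_ae (ContinuousMap.coeFn_toLp haarTorus _)

/-! ## The Hardy space of exponent two -/

lemma norm_le_hardy {p : ℝ≥0∞} [Fact (1 ≤ p)] (F : Hardy p) (r : Set.Ioo (0 : ℝ) 1) :
    ‖ContinuousMap.toLp p haarTorus ℂ (F.2.1.dilateMap r)‖ ≤ ‖F‖ := by
  rw [← toReal_enorm, enorm_toLp_dilateMap]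
  exact ENNReal.toReal_mono F.2.2.ne (le_iSup (fun r => eLpNorm (dilate F.1 r) p haarTorus) r)

/-- Used to remove the factors `r ^ deg n` from finite sums by letting `r` tend to `1`. -/
lemma tendsto_pow_one {f : ℝ → ℝ} (hf : Continuous f) {B : ℝ}
    (h : ∀ r : Set.Ioo (0 : ℝ) 1, f r ≤ B) : f 1 ≤ B := by
  have h1 : Tendsto f (𝓝[<] 1) (𝓝 (f 1)) := hf.continuousWithinAt
  refine le_of_tendsto h1 ?_
  filter_upwards [Ioo_mem_nhdsLT (zero_lt_one' ℝ)] with r hr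
  exact h ⟨r, hr⟩

/-- Bessel's inequality for a function whose dilations have Fourier coefficients `a n * r ^ deg n`. -/
lemma sum_sq_le_of_fourier (F : Hardy 2) {a : ℕ+ → ℂ}
    (h : ∀ r n, ∫ w, F.2.1.dilateMap r w * chiMap (-intExponents n) w ∂haarTorus
      = a n * (((r : ℝ) ^ deg n : ℝ) : ℂ)) (s : Finset ℕ+) : ∑ n ∈ s, ‖a n‖ ^ 2 ≤ ‖F‖ ^ 2 := by
  have key := tendsto_pow_one (f := fun r => ∑ n ∈ s, (‖a n‖ * |r ^ deg n|) ^ 2) (B := ‖F‖ ^ 2)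
    (by fun_prop) fun r => by
      have h1 := (orthonormal_chiL2.comp _ intExponents_injective).sum_inner_products_le
        (ContinuousMap.toLp 2 haarTorus ℂ (F.2.1.dilateMap r)) (s := s)
      simp only [Function.comp_apply, inner_chiL2, h, norm_mul, Complex.norm_real,
        Real.norm_eq_abs] at h1
      exact h1.trans (pow_le_pow_left₀ (norm_nonneg _) (norm_le_hardy F r) 2)
  simpa using key

lemma HasMonomialExpansion.sum_sq_le {F : Hardy 2} {a : ℕ+ → ℂ} (h : HasMonomialExpansion F a)
    (s : Finset ℕ+) : ∑ n ∈ s, ‖a n‖ ^ 2 ≤ ‖F‖ ^ 2 :=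
  sum_sq_le_of_fourier F (fun r n => h.fourier_dilateMap F.2.1 r n) s

lemma norm_le_of_summable_sq {a : ℕ+ → ℂ} (h : Summable fun n => ‖a n‖ ^ 2) (n : ℕ+) :
    ‖a n‖ ≤ √(∑' n, ‖a n‖ ^ 2) :=
  Real.le_sqrt_of_sq_le (h.le_tsum n fun _ _ => sq_nonneg _)

lemma norm_sq_sum_of_orthonormal {ι E : Type*} [NormedAddCommGroup E] [InnerProductSpace ℂ E]
    {v : ι → E} (hv : Orthonormal ℂ v) (c : ι → ℂ) (s : Finset ι) :
    ‖∑ i ∈ s, c i • v i‖ ^ 2 = ∑ i ∈ s, ‖c i‖ ^ 2 := by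
  have h := hv.inner_sum c c s
  rw [inner_self_eq_norm_sq_to_K] at h
  have h2 : ∀ i, (starRingEnd ℂ) (c i) * c i = ((‖c i‖ ^ 2 : ℝ) : ℂ) := fun i => by
    rw [Complex.conj_mul']; push_cast; rfl
  simp_rw [h2] at h
  refine Complex.ofReal_injective (Eq.trans ?_ (h.trans ?_)) <;> push_cast <;> rfl

/-- By orthonormality the partial sums of a dilation have squared norm `∑ ‖a n‖² r ^ (2 deg n)`, and
`r < 1`. -/
lemma hardyENorm_monomialSum_le {a : ℕ+ → ℂ} (h : Summable fun n => ‖a n‖ ^ 2) :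
    hardyENorm 2 (monomialSum a) ≤ ENNReal.ofReal √(∑' n, ‖a n‖ ^ 2) := by
  have hb := norm_le_of_summable_sq h
  have hF := isAnalytic_monomialSum hb
  refine iSup_le fun r => ?_
  rw [← enorm_toLp_dilateMap 2 hF r, ← ofReal_norm]
  refine ENNReal.ofReal_le_ofReal ?_
  have hs := ((hasMonomialExpansion_monomialSum hb).hasSum_dilateMap hF r).mapL
    (ContinuousMap.toLp 2 haarTorus ℂ)
  refine le_of_tendsto (Tendsto.norm hs) (Eventually.of_forall fun s => ?_)
  refine Real.le_sqrt_of_sq_le ?_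
  simp_rw [map_smul]
  have := norm_sq_sum_of_orthonormal (orthonormal_chiL2.comp _ intExponents_injective)
    (fun n => a n * (((r : ℝ) ^ deg n : ℝ) : ℂ)) s
  refine this.le.trans ((Finset.sum_le_sum fun n _ => ?_).trans
    (h.sum_le_tsum s fun _ _ => sq_nonneg _))
  rw [norm_mul, Complex.norm_real, Real.norm_of_nonneg (pow_nonneg r.2.1.le _)]
  refine pow_le_pow_left₀ (mul_nonneg (norm_nonneg _) (pow_nonneg r.2.1.le _)) ?_ 2
  exact mul_le_of_le_one_right (norm_nonneg _) (pow_le_one₀ r.2.1.le r.2.2.le)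

/-- Square-summable coefficients define a function in the Hardy space of exponent two. -/
lemma exists_hardy_two {a : ℕ+ → ℂ} (h : Summable fun n => ‖a n‖ ^ 2) :
    ∃ F : Hardy 2, HasMonomialExpansion F a :=
  ⟨⟨monomialSum a, isAnalytic_monomialSum (norm_le_of_summable_sq h),
    (hardyENorm_monomialSum_le h).trans_lt ENNReal.ofReal_lt_top⟩,
    hasMonomialExpansion_monomialSum (norm_le_of_summable_sq h)⟩

/-! ## Monomial expansions of functions in the Hardy space of exponent two -/

/-- A function holomorphic on a disk of radius larger than one is the sum of an absolutely
convergent power series on the closed unit disk. -/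
lemma exists_taylor {φ : ℂ → ℂ} {R : ℝ} (hR : 1 < R) (hφ : DifferentiableOn ℂ φ (Metric.ball 0 R)) :
    ∃ c : ℕ → ℂ, (Summable fun m => ‖c m‖) ∧
      ∀ z : ℂ, ‖z‖ ≤ 1 → HasSum (fun m => c m * z ^ m) (φ z) := by
  have h : ∀ z : ℂ, ‖z‖ ≤ 1 → HasSum (fun m => ((m.factorial : ℂ)⁻¹ * iteratedDeriv m φ 0) * z ^ m)
      (φ z) := fun z hz => by
    have := Complex.hasSum_taylorSeries_on_ball hφ
      (show z ∈ Metric.ball 0 R by rw [mem_ball_zero_iff]; linarith)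
    refine this.congr_fun fun m => ?_
    simp only [sub_zero, smul_eq_mul]
    ring
  exact ⟨_, by simpa using (h 1 (by simp)).summable.norm, h⟩

lemma chiMap_single_natCast (m : ℕ) (v : Torus) :
    chiMap (Finsupp.single 0 (m : ℤ)) v = (v 0 : ℂ) ^ m := by
  rw [chiMap_apply, chi, Finsupp.prod_single_index (zpow_zero _), zpow_natCast, Circle.coe_pow]

/-- The Fourier coefficients of a holomorphic function on a circle of radius `t ≤ 1`. -/
lemma taylor_fourier {φ : ℂ → ℂ} {R : ℝ} (hR : 1 < R)
    (hφ : DifferentiableOn ℂ φ (Metric.ball 0 R)) {t : ℝ} (ht0 : 0 ≤ t) (ht1 : t ≤ 1) :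
    (∀ k : ℕ, ∫ v : Torus, φ (t * v 0) * chiMap (-Finsupp.single 0 (k : ℤ)) v ∂haarTorus
      = t ^ k * ∫ v : Torus, φ (v 0) * chiMap (-Finsupp.single 0 (k : ℤ)) v ∂haarTorus) ∧
    ∀ k : ℤ, k < 0 →
      ∫ v : Torus, φ (t * v 0) * chiMap (-Finsupp.single 0 k) v ∂haarTorus = 0 := by
  obtain ⟨c, hc, hsum⟩ := exists_taylor hR hφ
  -- The zeroth coordinate of the infinite torus plays the role of the unit circle, so the Fourier
  -- calculus above also serves one variable.
  have hinj : Function.Injective fun m : ℕ => (Finsupp.single 0 (m : ℤ) : ℕ →₀ ℤ) :=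
    (Finsupp.single_injective 0).comp Nat.cast_injective
  have hmap : ∀ s : ℝ, 0 ≤ s → s ≤ 1 → ∃ f : C(Torus, ℂ), (∀ v, f v = φ (s * v 0)) ∧
      HasSum (fun m : ℕ => (c m * s ^ m) • chiMap (Finsupp.single 0 (m : ℤ))) f := by
    intro s hs0 hs1
    have hn : ∀ v : Torus, ‖(s : ℂ) * v 0‖ ≤ 1 := fun v => by
      rwa [norm_mul, Circle.norm_coe, mul_one, Complex.norm_real, Real.norm_of_nonneg hs0]
    have hcont : Continuous fun v : Torus => φ (s * v 0) := by
      refine hφ.continuousOn.comp_continuous (by fun_prop) fun v => ?_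
      rw [mem_ball_zero_iff]
      linarith [hn v]
    refine ⟨⟨_, hcont⟩, fun v => rfl, hasSum_chiMap ?_ fun w => ?_⟩
    · refine hc.of_nonneg_of_le (fun _ => norm_nonneg _) fun m => ?_
      rw [norm_mul, norm_pow, Complex.norm_real, Real.norm_of_nonneg hs0]
      exact mul_le_of_le_one_right (norm_nonneg _) (pow_le_one₀ hs0 hs1)
    · refine (hsum _ (hn w)).congr_fun fun m => ?_
      rw [chiMap_single_natCast]
      ring
  obtain ⟨f, hf, hfs⟩ := hmap t ht0 ht1
  obtain ⟨g, hg, hgs⟩ := hmap 1 zero_le_one le_rfl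
  simp_rw [Complex.ofReal_one, one_mul] at hg
  refine ⟨fun k => ?_, fun k hk => ?_⟩
  · simp_rw [← hf, ← hg]
    rw [integral_mul_chiMap_of_mem hfs hinj k, integral_mul_chiMap_of_mem hgs hinj k]
    simp [mul_comm]
  · simp_rw [← hf]
    refine integral_mul_chiMap_of_notMem hfs fun m h => ?_
    have := Finsupp.single_injective 0 h
    omega

/-! ### Homogeneity of the Fourier coefficients of analytic functions -/

/-- The restriction of a sequence to a set of coordinates. -/
def restr (S : Set ℕ) (ζ : Ell1) : Ell1 :=
  ⟨S.indicator ζ, memℓp_gen (by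
    simp only [ENNReal.toReal_one, Real.rpow_one]
    exact (summable_norm_coord ζ).of_nonneg_of_le (fun _ => norm_nonneg _)
      fun j => norm_indicator_le_norm_self _ _)⟩

lemma restr_apply (S : Set ℕ) (ζ : Ell1) (j : ℕ) : restr S ζ j = S.indicator ζ j := rfl

lemma restr_compl_add_apply_of_mem {S : Set ℕ} (ζ : Ell1) (z : ℂ) {j : ℕ} (hj : j ∈ S) :
    (restr Sᶜ ζ + z • restr S ζ) j = z * ζ j := by
  change restr Sᶜ ζ j + z * restr S ζ j = _
  simp [restr_apply, hj]

lemma restr_compl_add_apply_of_notMem {S : Set ℕ} (ζ : Ell1) (z : ℂ) {j : ℕ} (hj : j ∉ S) :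
    (restr Sᶜ ζ + z • restr S ζ) j = ζ j := by
  change restr Sᶜ ζ j + z * restr S ζ j = _
  simp [restr_apply, hj]

/-- Rotations preserve the moduli of the coordinates, so one radius `c⁻¹` serves every `w`. -/
lemma exists_ball_subset_line (S : Set ℕ) (ζ : polydisk) :
    ∃ R > (1 : ℝ), ∀ w : Torus, ∀ z ∈ Metric.ball (0 : ℂ) R,
      restr Sᶜ (rot w ζ : Ell1) + z • restr S (rot w ζ : Ell1) ∈ polydisk := by
  obtain ⟨c, hc, ε, hε, h⟩ := exists_coord_le ζ
  have hc0 : 0 < c := by linarith [h 0, norm_nonneg ((ζ : Ell1) 0)]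
  refine ⟨c⁻¹, (one_lt_inv₀ hc0).2 hc, fun w z hz j => ?_⟩
  rw [mem_ball_zero_iff] at hz
  by_cases hj : j ∈ S
  · rw [restr_compl_add_apply_of_mem _ _ hj, norm_mul, rot_apply, norm_coe_mul]
    calc ‖z‖ * ‖(ζ : Ell1) j‖ ≤ ‖z‖ * c := by gcongr; linarith [h j]
      _ < c⁻¹ * c := by gcongr
      _ = 1 := inv_mul_cancel₀ hc0.ne'
  · rw [restr_compl_add_apply_of_notMem _ _ hj]
    exact (rot w ζ).2 j

/-- Multiplication of the coordinates in `S` by `t ∈ [0, 1]`. -/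
def scale (S : Set ℕ) (t : Set.Icc (0 : ℝ) 1) (ζ : polydisk) : polydisk :=
  ⟨restr Sᶜ (ζ : Ell1) + ((t : ℝ) : ℂ) • restr S (ζ : Ell1), fun j => by
    by_cases hj : j ∈ S
    · rw [restr_compl_add_apply_of_mem _ _ hj, norm_mul, Complex.norm_real,
        Real.norm_of_nonneg t.2.1]
      exact (mul_le_of_le_one_left (norm_nonneg _) t.2.2).trans_lt (ζ.2 j)
    · rw [restr_compl_add_apply_of_notMem _ _ hj]
      exact ζ.2 j⟩

lemma scale_apply_of_mem {S : Set ℕ} (t : Set.Icc (0 : ℝ) 1) (ζ : polydisk) {j : ℕ} (hj : j ∈ S) :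
    (scale S t ζ : Ell1) j = ((t : ℝ) : ℂ) * (ζ : Ell1) j :=
  restr_compl_add_apply_of_mem _ _ hj

lemma scale_apply_of_notMem {S : Set ℕ} (t : Set.Icc (0 : ℝ) 1) (ζ : polydisk) {j : ℕ}
    (hj : j ∉ S) : (scale S t ζ : Ell1) j = (ζ : Ell1) j :=
  restr_compl_add_apply_of_notMem _ _ hj

lemma polydisk_ext {ζ ξ : polydisk} (h : ∀ j, (ζ : Ell1) j = (ξ : Ell1) j) : ζ = ξ :=
  Subtype.ext (lp.ext (funext h))

lemma scale_one (S : Set ℕ) (ζ : polydisk) : scale S 1 ζ = ζ := polydisk_ext fun j => by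
  by_cases hj : j ∈ S
  · simp [scale_apply_of_mem _ _ hj]
  · rw [scale_apply_of_notMem _ _ hj]

/-- The Fourier coefficient of index `α` of the function `w ↦ F (w ζ)` on the torus. -/
def rotCoeff (F : polydisk → ℂ) (α : ℕ →₀ ℤ) (ζ : polydisk) : ℂ :=
  ∫ w, F (rot w ζ) * chiMap (-α) w ∂haarTorus

/-- The torus element with entries `u` in `S` and `1` elsewhere. -/
def diag (S : Set ℕ) (u : Circle) : Torus := S.mulIndicator fun _ => u

lemma continuous_diag (S : Set ℕ) : Continuous (diag S) := by
  refine continuous_pi fun j => ?_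
  by_cases hj : j ∈ S
  · simpa [diag, hj] using continuous_id'
  · simpa [diag, hj] using continuous_const

/-- Rotating and scaling the coordinates in `S` together amounts to evaluation on a complex line at
`z = t u`. -/
lemma rot_mul_diag_scale (F : polydisk → ℂ) (S : Set ℕ) (w : Torus) (u : Circle)
    (t : Set.Icc (0 : ℝ) 1) (ζ : polydisk) :
    F (rot (w * diag S u) (scale S t ζ)) = ext0 F (restr Sᶜ (rot w ζ : Ell1)
      + (((t : ℝ) : ℂ) * u) • restr S (rot w ζ : Ell1)) := by
  rw [← ext0_coe F]
  congr 1
  refine lp.ext (funext fun j => ?_)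
  rw [rot_apply, Pi.mul_apply, Circle.coe_mul]
  by_cases hj : j ∈ S
  · rw [restr_compl_add_apply_of_mem _ _ hj, scale_apply_of_mem _ _ hj, rot_apply, diag,
      Set.mulIndicator_of_mem hj]
    ring
  · rw [restr_compl_add_apply_of_notMem _ _ hj, scale_apply_of_notMem _ _ hj, rot_apply, diag,
      Set.mulIndicator_of_notMem hj]
    simp

/-- Haar invariance inserts an extra rotation `u` of the coordinates in `S`. Averaging over `u` and
exchanging the integrals exhibits an inner one-variable Fourier coefficient, of a function
holomorphic on a disk of radius larger than one. -/
lemma rotCoeff_scale_eq_integral {F : polydisk → ℂ} (hF : IsAnalytic F) {S : Set ℕ} {α : ℕ →₀ ℤ}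
    {k : ℤ} (hk : ∀ u, chi α (diag S u) = u ^ k) (t : Set.Icc (0 : ℝ) 1) (ζ : polydisk) :
    rotCoeff F α (scale S t ζ) = ∫ w, (∫ v : Torus, ext0 F (restr Sᶜ (rot w ζ : Ell1)
      + (((t : ℝ) : ℂ) * v 0) • restr S (rot w ζ : Ell1)) * chiMap (-Finsupp.single 0 k) v
        ∂haarTorus) * chiMap (-α) w ∂haarTorus := by
  have hchi : ∀ v : Torus, chiMap (-α) (diag S (v 0)) = chiMap (-Finsupp.single 0 k) v := by
    intro v
    rw [chiMap_apply, chiMap_apply, chi_neg, chi_neg, hk, chi,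
      Finsupp.prod_single_index (zpow_zero _)]
  have h1 : ∀ v : Torus, rotCoeff F α (scale S t ζ)
      = ∫ w, F (rot (w * diag S (v 0)) (scale S t ζ)) * chiMap (-α) (w * diag S (v 0))
        ∂haarTorus := fun v =>
    (integral_mul_right_eq_self (μ := haarTorus)
      (fun w => F (rot w (scale S t ζ)) * chiMap (-α) w) (diag S (v 0))).symm
  have hd : Continuous fun q : Torus × Torus => q.2 * diag S (q.1 0) :=
    continuous_snd.mul ((continuous_diag S).comp ((continuous_apply 0).comp continuous_fst))
  have hcont : Continuous fun q : Torus × Torus =>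
      F (rot (q.2 * diag S (q.1 0)) (scale S t ζ)) * chiMap (-α) (q.2 * diag S (q.1 0)) :=
    ((hF.continuous.comp (continuous_rot _)).comp hd).mul ((chiMap (-α)).continuous.comp hd)
  calc rotCoeff F α (scale S t ζ) = ∫ v : Torus, (∫ w, F (rot (w * diag S (v 0)) (scale S t ζ))
        * chiMap (-α) (w * diag S (v 0)) ∂haarTorus) ∂haarTorus := by
        simp_rw [← h1]
        simp
    _ = ∫ w, (∫ v : Torus, F (rot (w * diag S (v 0)) (scale S t ζ))
        * chiMap (-α) (w * diag S (v 0)) ∂haarTorus) ∂haarTorus :=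
        integral_integral_swap (hcont.integrable_of_hasCompactSupport
          (HasCompactSupport.of_compactSpace _))
    _ = _ := by
        refine integral_congr_ae (Eventually.of_forall fun w => ?_)
        change _ = _ * _
        rw [← integral_mul_const]
        refine integral_congr_ae (Eventually.of_forall fun v => ?_)
        change _ * chiMap (-α) (w * diag S (v 0)) = _ * _ * _
        rw [rot_mul_diag_scale F, ← hchi, chiMap_apply, chiMap_apply, chiMap_apply, chi_mul,
          Circle.coe_mul]
        ring

lemma IsAnalytic.differentiableOn_line {F : polydisk → ℂ} (hF : IsAnalytic F) (S : Set ℕ)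
    (ζ : polydisk) : ∃ R > (1 : ℝ), ∀ w : Torus, DifferentiableOn ℂ
      (fun z : ℂ => ext0 F (restr Sᶜ (rot w ζ : Ell1) + z • restr S (rot w ζ : Ell1)))
      (Metric.ball 0 R) := by
  obtain ⟨R, hR, h⟩ := exists_ball_subset_line S ζ
  refine ⟨R, hR, fun w => ?_⟩
  have h0 := h w 0 (Metric.mem_ball_self (by linarith))
  rw [zero_smul, add_zero] at h0
  exact (hF.analytic_line ⟨_, h0⟩ _).differentiableOn.mono fun z hz => h w z hz

/-- The inner integral is the `k`-th Taylor coefficient of `z ↦ φ (t z)`. The value `t = 0` is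
allowed: with `k = 0` it says that coordinates absent from the character may be set to zero. -/
lemma rotCoeff_scale {F : polydisk → ℂ} (hF : IsAnalytic F) {S : Set ℕ} {α : ℕ →₀ ℤ} {k : ℕ}
    (hk : ∀ u, chi α (diag S u) = u ^ k) (t : Set.Icc (0 : ℝ) 1) (ζ : polydisk) :
    rotCoeff F α (scale S t ζ) = ((t : ℝ) : ℂ) ^ k * rotCoeff F α ζ := by
  obtain ⟨R, hR, hd⟩ := hF.differentiableOn_line S ζ
  have hk' : ∀ u, chi α (diag S u) = u ^ (k : ℤ) := fun u => by rw [hk, zpow_natCast]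
  have h1 := rotCoeff_scale_eq_integral hF hk' 1 ζ
  rw [scale_one] at h1
  rw [rotCoeff_scale_eq_integral hF hk', h1, ← integral_const_mul]
  refine integral_congr_ae (Eventually.of_forall fun w => ?_)
  change _ * _ = _ * (_ * _)
  rw [(taylor_fourier hR (hd w) t.2.1 t.2.2).1 k, ← mul_assoc]
  simp

/-- A Taylor series in the `j`-th coordinate contains no negative powers. -/
lemma rotCoeff_eq_zero {F : polydisk → ℂ} (hF : IsAnalytic F) {α : ℕ →₀ ℤ} {j : ℕ}
    (hj : α j < 0) (ζ : polydisk) : rotCoeff F α ζ = 0 := by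
  obtain ⟨R, hR, hd⟩ := hF.differentiableOn_line {j} ζ
  have hk : ∀ u, chi α (diag {j} u) = u ^ α j := fun u => by
    rw [diag, Set.mulIndicator_singleton, chi_mulSingle]
  rw [← scale_one {j} ζ, rotCoeff_scale_eq_integral hF hk]
  simp_rw [(taylor_fourier hR (hd _) (t := ((1 : Set.Icc (0 : ℝ) 1) : ℝ)) zero_le_one le_rfl).2 _ hj]
  simp

lemma chi_diag_singleton_intExponents (n : ℕ+) (m : ℕ) (u : Circle) :
    chi (intExponents n) (diag {m} u) = u ^ primeExponents n m := by
  rw [diag, Set.mulIndicator_singleton, chi_mulSingle, intExponents, Finsupp.mapRange_apply,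
    zpow_natCast]

lemma dilPoint_one_apply (r : Set.Ioo (0 : ℝ) 1) (j : ℕ) :
    (dilPoint r 1 : Ell1) j = ((r : ℝ) : ℂ) ^ (j + 1) := by
  change ((r : ℝ) : ℂ) ^ (j + 1) * ((1 : Circle) : ℂ) = _
  rw [Circle.coe_one, mul_one]

/-- The Fourier coefficients of dilations depend on the dilation parameter through its power with
exponent the degree. -/
lemma rotCoeff_dilPoint_of_le {F : polydisk → ℂ} (hF : IsAnalytic F) (n : ℕ+)
    {r s : Set.Ioo (0 : ℝ) 1} (hrs : r ≤ s) :
    rotCoeff F (intExponents n) (dilPoint r 1)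
      = (((r : ℝ) / s : ℝ) : ℂ) ^ deg n * rotCoeff F (intExponents n) (dilPoint s 1) := by
  have hs0 : (0 : ℝ) < s := s.2.1
  set t : ℝ := (r : ℝ) / s with ht
  have ht0 : 0 ≤ t := div_nonneg r.2.1.le hs0.le
  have ht1 : t ≤ 1 := (div_le_one hs0).2 hrs
  -- The radius is changed from `s` to `r` one coordinate at a time; the `m`-th change scales that
  -- coordinate by `t ^ (m + 1)`.
  have hmix : ∀ N : ℕ, ∃ ξ : polydisk, (∀ j, (ξ : Ell1) j
      = if j < N then ((r : ℝ) : ℂ) ^ (j + 1) else ((s : ℝ) : ℂ) ^ (j + 1)) ∧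
      rotCoeff F (intExponents n) ξ
        = (∏ m ∈ Finset.range N, (t : ℂ) ^ ((m + 1) * primeExponents n m))
          * rotCoeff F (intExponents n) (dilPoint s 1) := by
    intro N
    induction N with
    | zero => exact ⟨dilPoint s 1, fun j => by simp [dilPoint_one_apply], by simp⟩
    | succ N ih =>
      obtain ⟨ξ, hξ, hJ⟩ := ih
      refine ⟨scale {N} ⟨t ^ (N + 1), pow_nonneg ht0 _, pow_le_one₀ ht0 ht1⟩ ξ, fun j => ?_, ?_⟩
      · by_cases hj : j = N
        · subst hj
          have hs' : ((s : ℝ) : ℂ) ≠ 0 := by exact_mod_cast hs0.ne'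
          rw [scale_apply_of_mem _ _ (Set.mem_singleton j), hξ, if_neg (lt_irrefl _), if_pos (Nat.lt_succ_self _)]
          change ((((r : ℝ) / s) ^ (j + 1) : ℝ) : ℂ) * _ = _
          push_cast
          rw [div_pow, div_mul_cancel₀ _ (pow_ne_zero _ hs')]
        · rw [scale_apply_of_notMem _ _ (by simpa using hj), hξ]
          have : j < N ↔ j < N + 1 := by omega
          simp only [this]
      · rw [rotCoeff_scale hF (chi_diag_singleton_intExponents n N), hJ, Finset.prod_range_succ,
          pow_mul]
        push_cast
        ring
  obtain ⟨N, hN⟩ : ∃ N, (primeExponents n).support ⊆ Finset.range N :=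
    ⟨(primeExponents n).support.sup id + 1, fun j hj =>
      Finset.mem_range.2 (Nat.lt_succ_of_le (Finset.le_sup (f := id) hj))⟩
  have htail : ∀ u, chi (intExponents n) (diag (Set.Ici N) u) = u ^ 0 := by
    intro u
    rw [pow_zero, chi, intExponents, Finsupp.prod_mapRange_index (fun _ => zpow_zero _)]
    refine Finset.prod_eq_one fun j hj => ?_
    have : j ∉ Set.Ici N := not_le.2 (Finset.mem_range.1 (hN hj))
    change diag (Set.Ici N) u j ^ _ = 1
    rw [diag, Set.mulIndicator_of_notMem this, one_zpow]
  -- The infinitely many remaining coordinates do not occur in the character. Setting them to zero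
  -- makes the two points agree, so no limit in `N` is needed.
  have hkill : ∀ ξ, rotCoeff F (intExponents n) (scale (Set.Ici N) 0 ξ)
      = rotCoeff F (intExponents n) ξ := fun ξ => by
    rw [rotCoeff_scale hF htail, pow_zero, one_mul]
  obtain ⟨ξ, hξ, hJ⟩ := hmix N
  have heq : scale (Set.Ici N) 0 (dilPoint r 1) = scale (Set.Ici N) 0 ξ := by
    refine polydisk_ext fun j => ?_
    by_cases hj : j ∈ Set.Ici N
    · simp [scale_apply_of_mem _ _ hj]
    · rw [scale_apply_of_notMem _ _ hj, scale_apply_of_notMem _ _ hj, hξ,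
        if_pos (not_le.1 hj), dilPoint_one_apply]
  rw [← hkill, heq, hkill, hJ, deg, Finsupp.sum_of_support_subset _ hN _ (by simp),
    Finset.prod_pow_eq_pow_sum]

/-- The Fourier coefficient at radius `r` divided by `r ^ deg n` does not depend on `r`, so it may
be read off at the arbitrary radius `1/2`. -/
lemma exists_coeff {F : polydisk → ℂ} (hF : IsAnalytic F) : ∃ a : ℕ+ → ℂ, ∀ r n,
    ∫ w, hF.dilateMap r w * chiMap (-intExponents n) w ∂haarTorus
      = a n * (((r : ℝ) ^ deg n : ℝ) : ℂ) := by
  have hrot : ∀ (r : Set.Ioo (0 : ℝ) 1) n, ∫ w, hF.dilateMap r w * chiMap (-intExponents n) w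
      ∂haarTorus = rotCoeff F (intExponents n) (dilPoint r 1) := by
    intro r n
    refine integral_congr_ae (Eventually.of_forall fun w => ?_)
    change F (dilPoint r w) * _ = _
    rw [dilPoint_eq_rot]
  let s : Set.Ioo (0 : ℝ) 1 := ⟨1 / 2, by norm_num, by norm_num⟩
  have hpos : ∀ r : Set.Ioo (0 : ℝ) 1, ((r : ℝ) : ℂ) ≠ 0 := fun r => by exact_mod_cast r.2.1.ne'
  refine ⟨fun n => rotCoeff F (intExponents n) (dilPoint s 1) / ((s : ℝ) : ℂ) ^ deg n,
    fun r n => ?_⟩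
  rw [hrot, div_mul_eq_mul_div, eq_div_iff (pow_ne_zero _ (hpos s))]
  push_cast
  rcases le_total r s with h | h
  · rw [rotCoeff_dilPoint_of_le hF n h]
    push_cast
    rw [div_pow]
    field_simp [hpos s]
  · rw [rotCoeff_dilPoint_of_le hF n h]
    push_cast
    rw [div_pow]
    field_simp [hpos r]

/-- Every function in the Hardy space of exponent two has a monomial expansion. -/
lemma exists_hasMonomialExpansion (F : Hardy 2) : ∃ a : ℕ+ → ℂ, HasMonomialExpansion F a := by
  obtain ⟨a, ha⟩ := exists_coeff F.2.1
  have hs : Summable fun n => ‖a n‖ ^ 2 :=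
    summable_of_sum_le (fun _ => sq_nonneg _) (sum_sq_le_of_fourier F ha)
  obtain ⟨G, hG⟩ := exists_hardy_two hs
  have hFG : F = G := by
    rw [← sub_eq_zero]
    refine Subtype.ext ((F - G).2.1.eq_zero_of_dilate fun r w => ?_)
    have hsub : ∀ v, (F - G).2.1.dilateMap r v = F.2.1.dilateMap r v - G.2.1.dilateMap r v :=
      fun v => rfl
    have hint : ∀ (H : Hardy 2) (α : ℕ →₀ ℤ),
        Integrable (fun w => H.2.1.dilateMap r w * chiMap α w) haarTorus := fun H α =>
      ((H.2.1.dilateMap r).continuous.mul (chiMap α).continuous).integrable_of_hasCompactSupport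
        (HasCompactSupport.of_compactSpace _)
    -- Nonnegative frequencies cancel by the choice of `G`; a negative entry kills the coefficient
    -- by analyticity.
    have h0 : (F - G).2.1.dilateMap r = 0 := by
      refine eq_zero_of_fourier fun α => ?_
      by_cases hα : ∀ j, 0 ≤ α j
      · obtain ⟨n, rfl⟩ := exists_intExponents_eq hα
        simp_rw [hsub, sub_mul]
        rw [integral_sub (hint F _) (hint G _), ha, hG.fourier_dilateMap G.2.1, sub_self]
      · push Not at hα
        obtain ⟨j, hj⟩ := hα
        rw [← rotCoeff_eq_zero (F - G).2.1 hj (dilPoint r 1)]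
        refine integral_congr_ae (Eventually.of_forall fun w => ?_)
        change (F - G).1 (dilPoint r w) * _ = _
        rw [dilPoint_eq_rot]
    exact congrArg (fun f : C(Torus, ℂ) => f w) h0
  exact ⟨a, hFG ▸ hG⟩

section

/-! ## Partial sums of monomial series in Hardy spaces -/

lemma hasMonomialExpansion_monomial (n : ℕ+) :
    HasMonomialExpansion (monomial n) (Pi.single n 1) := fun ζ => by
  classical
  have : (fun m => (Pi.single n 1 : ℕ+ → ℂ) m * monomial m ζ)
      = fun m => if m = n then monomial n ζ else 0 := by
    funext m
    by_cases h : m = n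
    · subst h; simp
    · simp [h]
  rw [this]
  exact hasSum_ite_eq n _

lemma isAnalytic_monomial (n : ℕ+) : IsAnalytic (monomial n) := by
  rw [(hasMonomialExpansion_monomial n).eq_monomialSum]
  refine isAnalytic_monomialSum (A := 1) fun m => ?_
  by_cases h : m = n
  · subst h; simp
  · simp [h]

variable (p : ℝ≥0∞) [Fact (1 ≤ p)]

/-- The monomial of index `n` as an element of the Hardy space. -/
def mono (n : ℕ+) : Hardy p := ⟨monomial n, isAnalytic_monomial n, by
  refine lt_of_le_of_lt (iSup_le fun r => ?_) ENNReal.one_lt_top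
  simpa using eLpNorm_le_of_ae_bound (p := p) (μ := haarTorus) (f := dilate (monomial n) r)
    (Eventually.of_forall fun w => norm_monomial_le_one n (dilPoint r w))⟩

variable {p}

/-- The dilation of a Hardy function as an element of `L^p` of the torus. -/
def dilateLp (r : Set.Ioo (0 : ℝ) 1) : Hardy p →ₗ[ℂ] Lp ℂ p haarTorus where
  toFun F := ContinuousMap.toLp p haarTorus ℂ (F.2.1.dilateMap r)
  map_add' F G := by
    rw [← map_add]
    rfl
  map_smul' c F := by
    rw [RingHom.id_apply, ← map_smul]
    rfl

lemma enorm_dilateLp (r : Set.Ioo (0 : ℝ) 1) (F : Hardy p) :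
    ‖dilateLp r F‖ₑ = eLpNorm (dilate F r) p haarTorus := enorm_toLp_dilateMap p F.2.1 r

lemma enorm_hardy (F : Hardy p) : ‖F‖ₑ = hardyENorm p F := by
  rw [← ofReal_norm]
  exact ENNReal.ofReal_toReal F.2.2.ne

lemma enorm_hardy_eq_iSup (F : Hardy p) : ‖F‖ₑ = ⨆ r, ‖dilateLp r F‖ₑ := by
  simp_rw [enorm_hardy, enorm_dilateLp]
  rfl

lemma enorm_dilateLp_le (r : Set.Ioo (0 : ℝ) 1) (F : Hardy p) : ‖dilateLp r F‖ₑ ≤ ‖F‖ₑ := by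
  rw [enorm_hardy_eq_iSup]
  exact le_iSup (fun r => ‖dilateLp r F‖ₑ) r

/-- The dilations of the partial sums of the monomial series converge in `L^p`. -/
lemma HasMonomialExpansion.hasSum_dilateLp {G : Hardy p} {b : ℕ+ → ℂ}
    (h : HasMonomialExpansion G b) (r : Set.Ioo (0 : ℝ) 1) :
    HasSum (fun n => dilateLp r (b n • mono p n)) (dilateLp r G) := by
  convert! (h.hasSum_dilateMap G.2.1 r).mapL (ContinuousMap.toLp p haarTorus ℂ) using 2 with n
  refine congrArg (ContinuousMap.toLp p haarTorus ℂ) (ContinuousMap.ext fun w => ?_)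
  change b n * monomial n (dilPoint r w) = b n * _ * chiMap (intExponents n) w
  rw [monomial_dilPoint, mul_assoc]

/-- An exhausting sequence of finite sets of indices. -/
def initial (M : ℕ) : Finset ℕ+ := Finset.Iic M.succPNat

lemma tendsto_initial : Tendsto initial atTop atTop := by
  refine tendsto_atTop_finset_of_monotone (fun a b h => Finset.Iic_subset_Iic.2 ?_) fun n => ?_
  · exact Nat.succPNat_le_succPNat.2 h
  · refine ⟨n, Finset.mem_Iic.2 ?_⟩
    rw [← PNat.coe_le_coe, Nat.succPNat_coe]
    exact Nat.le_succ _

/-- The partial sum over `s` of the monomial series with coefficients `b`. -/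
def partialSum (p : ℝ≥0∞) [Fact (1 ≤ p)] (s : Finset ℕ+) (b : ℕ+ → ℂ) : Hardy p :=
  ∑ n ∈ s, b n • mono p n

lemma HasMonomialExpansion.tendsto_dilateLp {G : Hardy p} {b : ℕ+ → ℂ}
    (h : HasMonomialExpansion G b) (r : Set.Ioo (0 : ℝ) 1) :
    Tendsto (fun M => dilateLp r (partialSum p (initial M) b)) atTop (𝓝 (dilateLp r G)) := by
  simp_rw [partialSum, map_sum]
  exact (h.hasSum_dilateLp r).comp tendsto_initial

/-- The Hardy norm is lower semicontinuous along partial sums. -/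
lemma HasMonomialExpansion.enorm_sub_le_liminf {G : Hardy p} {b : ℕ+ → ℂ}
    (h : HasMonomialExpansion G b) (H : Hardy p) :
    ‖G - H‖ₑ ≤ liminf (fun M => ‖partialSum p (initial M) b - H‖ₑ) atTop := by
  rw [enorm_hardy_eq_iSup]
  refine iSup_le fun r => ?_
  have h1 : Tendsto (fun M => ‖dilateLp r (partialSum p (initial M) b - H)‖ₑ) atTop
      (𝓝 ‖dilateLp r (G - H)‖ₑ) := by
    simp_rw [map_sub]
    exact ((h.tendsto_dilateLp r).sub_const _).enorm
  rw [← h1.liminf_eq]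
  exact liminf_le_liminf (Eventually.of_forall fun M => enorm_dilateLp_le r _)

lemma partialSum_add (s : Finset ℕ+) (b c : ℕ+ → ℂ) :
    partialSum p s (b + c) = partialSum p s b + partialSum p s c := by
  simp [partialSum, add_smul, Finset.sum_add_distrib]

lemma partialSum_smul (s : Finset ℕ+) (z : ℂ) (b : ℕ+ → ℂ) :
    partialSum p s (z • b) = z • partialSum p s b := by
  simp [partialSum, mul_smul, Finset.smul_sum]

lemma hasMonomialExpansion_partialSum (s : Finset ℕ+) (b : ℕ+ → ℂ) :
    HasMonomialExpansion (partialSum p s b) (fun n => if n ∈ s then b n else 0) := by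
  classical
  intro ζ
  have h1 : (partialSum p s b) ζ = ∑ n ∈ s, b n * monomial n ζ := by
    let ev : Hardy p →ₗ[ℂ] ℂ :=
      { toFun := fun F => F ζ, map_add' := fun _ _ => rfl, map_smul' := fun _ _ => rfl }
    change ev (partialSum p s b) = _
    rw [partialSum, map_sum]
    refine Finset.sum_congr rfl fun n _ => ?_
    rw [map_smul]
    rfl
  rw [h1]
  have h2 : ∑ n ∈ s, b n * monomial n ζ = ∑ n ∈ s, (if n ∈ s then b n else 0) * monomial n ζ :=
    Finset.sum_congr rfl fun n hn => by simp [hn]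
  rw [h2]
  exact hasSum_sum_of_ne_finset_zero fun n hn => by simp [hn]

/-! ## The Hardy norm as a measurable function of the coefficients -/

instance : Nonempty (Set.Ioo (0 : ℝ) 1) := ⟨⟨1 / 2, by norm_num, by norm_num⟩⟩

/-- A dense sequence of dilation parameters. -/
def denseRadius : ℕ → Set.Ioo (0 : ℝ) 1 := TopologicalSpace.denseSeq _

/-- A measurable function of arbitrary coefficients which is the Hardy norm for the coefficients of
a Hardy function. -/
def coeffNorm (p : ℝ≥0∞) [Fact (1 ≤ p)] (b : ℕ+ → ℂ) : ℝ≥0∞ :=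
  ⨆ k : ℕ, limsup (fun M => ‖dilateLp (denseRadius k)
    (partialSum p (initial M) b)‖ₑ) atTop

/-- Only countably many radii and partial sums enter, and each partial sum depends continuously on
finitely many coefficients. -/
lemma measurable_coeffNorm : Measurable (coeffNorm p) := by
  refine Measurable.iSup fun k => Measurable.limsup fun M => ?_
  refine Continuous.measurable ?_
  simp_rw [partialSum, map_sum, map_smul]
  fun_prop

lemma limsup_le_coeffNorm (b : ℕ+ → ℂ) (k : ℕ) :
    limsup (fun M => ‖dilateLp (denseRadius k) (partialSum p (initial M) b)‖ₑ) atTop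
      ≤ coeffNorm p b :=
  le_iSup (fun k => limsup (fun M => ‖dilateLp (denseRadius k)
    (partialSum p (initial M) b)‖ₑ) atTop) k

lemma limsup_add_le_ennreal {ι : Type*} {f : Filter ι} (u v : ι → ℝ≥0∞) :
    limsup (fun i => u i + v i) f ≤ limsup u f + limsup v f := by
  refine ENNReal.le_of_forall_pos_le_add fun ε hε hfin => ?_
  obtain ⟨hu, hv⟩ := ENNReal.add_lt_top.1 hfin
  have hε' : (ε : ℝ≥0∞) / 2 ≠ 0 := by simpa using hε.ne'
  have h1 := eventually_lt_of_limsup_lt (ENNReal.lt_add_right hu.ne hε')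
  have h2 := eventually_lt_of_limsup_lt (ENNReal.lt_add_right hv.ne hε')
  refine limsup_le_of_le (by isBoundedDefault) ?_
  filter_upwards [h1, h2] with i hi1 hi2
  refine (add_le_add hi1.le hi2.le).trans (le_of_eq ?_)
  rw [add_add_add_comm, ENNReal.add_halves]

lemma coeffNorm_add_le (b c : ℕ+ → ℂ) :
    coeffNorm p (b + c) ≤ coeffNorm p b + coeffNorm p c := by
  refine iSup_le fun k => ?_
  refine le_trans ?_ (add_le_add (limsup_le_coeffNorm b k) (limsup_le_coeffNorm c k))
  refine le_trans (limsup_le_limsup (Eventually.of_forall fun M => ?_))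
    (limsup_add_le_ennreal _ _)
  change ‖_‖ₑ ≤ _
  rw [partialSum_add, map_add]
  exact enorm_add_le _ _

lemma coeffNorm_smul (z : ℂ) (b : ℕ+ → ℂ) : coeffNorm p (z • b) = ‖z‖ₑ * coeffNorm p b := by
  simp_rw [coeffNorm, partialSum_smul, map_smul, enorm_smul, ENNReal.mul_iSup]
  exact iSup_congr fun k => ENNReal.limsup_const_mul_of_ne_top (by simp)

/-- Dominated convergence for series; the majorant is the series at a radius slightly larger than
`r`. -/
lemma HasMonomialExpansion.tendsto_dilate {G : polydisk → ℂ} {b : ℕ+ → ℂ}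
    (h : HasMonomialExpansion G b) {q : ℕ → Set.Ioo (0 : ℝ) 1} {r : Set.Ioo (0 : ℝ) 1}
    (hq : Tendsto q atTop (𝓝 r)) (w : Torus) :
    Tendsto (fun k => dilate G (q k) w) atTop (𝓝 (dilate G r w)) := by
  obtain ⟨ρ, hrρ, hρ⟩ := exists_between r.2.2
  let ρ' : Set.Ioo (0 : ℝ) 1 := ⟨ρ, r.2.1.trans hrρ, hρ⟩
  have hlim : Tendsto (fun k => (q k : ℝ)) atTop (𝓝 r) := (continuous_subtype_val.tendsto r).comp hq
  have hsum : ∀ s : Set.Ioo (0 : ℝ) 1, dilate G s w = ∑' n, b n * monomial n (dilPoint s w) :=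
    fun s => (h (dilPoint s w)).tsum_eq.symm
  simp_rw [hsum]
  refine tendsto_tsum_of_dominated_convergence (h (dilPoint ρ' w)).summable.norm (fun n => ?_) ?_
  · simp_rw [monomial_dilPoint]
    exact (((Complex.continuous_ofReal.tendsto _).comp (hlim.pow _)).mul_const _).const_mul _
  · filter_upwards [hlim.eventually (gt_mem_nhds hrρ)] with k hk n
    simp only [monomial_dilPoint, norm_mul, Complex.norm_real, norm_pow, Real.norm_of_nonneg
      (q k).2.1.le, Real.norm_of_nonneg ρ'.2.1.le]
    have := (q k).2.1.le
    have h2 : ((q k : ℝ)) ^ deg n ≤ (ρ' : ℝ) ^ deg n := pow_le_pow_left₀ this hk.le _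
    gcongr

/-- At a fixed radius the partial sums converge, so the limsup is a limit. A dense set of radii
suffices because `L^p` norms are lower semicontinuous under the pointwise convergence of dilations.
-/
lemma HasMonomialExpansion.coeffNorm_eq {G : Hardy p} {b : ℕ+ → ℂ}
    (h : HasMonomialExpansion G b) : coeffNorm p b = ‖G‖ₑ := by
  have h1 : coeffNorm p b
      = ⨆ k, ‖dilateLp (denseRadius k) G‖ₑ :=
    iSup_congr fun k => (h.tendsto_dilateLp _).enorm.limsup_eq
  rw [h1]
  refine le_antisymm (iSup_le fun k => enorm_dilateLp_le _ _) ?_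
  rw [enorm_hardy]
  refine iSup_le fun r => ?_
  obtain ⟨q, hq, hqr⟩ := mem_closure_iff_seq_limit.1
    (TopologicalSpace.denseRange_denseSeq (Set.Ioo (0 : ℝ) 1) r)
  refine (Lp.eLpNorm_lim_le_liminf_eLpNorm (f := fun k => dilate G (q k))
    (fun k => G.2.1.aestronglyMeasurable_dilate _) _
    (Eventually.of_forall fun w => h.tendsto_dilate hqr w)).trans ?_
  refine liminf_le_of_frequently_le' (Eventually.of_forall fun k => ?_).frequently
  obtain ⟨m, hm⟩ := hq k
  rw [← enorm_dilateLp, ← hm]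
  exact le_iSup (fun k => ‖dilateLp (denseRadius k) G‖ₑ) m

end

section

/-! ## A uniform bound in probability -/

/-- The space of square-summable coefficients. -/
abbrev Ell2 : Type := lp (fun _ : ℕ+ => ℂ) 2

lemma summable_sq_coord (a : Ell2) : Summable fun n => ‖a n‖ ^ 2 := by
  simpa using (lp.memℓp a).summable (by simp)

lemma norm_sq_eq_tsum_coord (a : Ell2) : ‖a‖ ^ 2 = ∑' n, ‖a n‖ ^ 2 := by
  simpa using lp.norm_rpow_eq_tsum (p := 2) (by simp) a

lemma continuous_coord (n : ℕ+) : Continuous fun a : Ell2 => a n :=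
  (lp.evalCLM ℂ (fun _ : ℕ+ => ℂ) 2 n).continuous

/-- The coefficients of the randomization. -/
def randomize {Ω : Type*} (X : ℕ+ → Ω → ℝ) (a : ℕ+ → ℂ) (ω : Ω) (n : ℕ+) : ℂ := a n * (X n ω : ℂ)

variable {Ω : Type*} {X : ℕ+ → Ω → ℝ}

lemma randomize_add (a b : ℕ+ → ℂ) (ω : Ω) :
    randomize X (a + b) ω = randomize X a ω + randomize X b ω :=
  funext fun _ => add_mul _ _ _

lemma randomize_sub (a b : ℕ+ → ℂ) (ω : Ω) :
    randomize X (a - b) ω = randomize X a ω - randomize X b ω :=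
  funext fun _ => sub_mul _ _ _

lemma randomize_smul (z : ℂ) (a : ℕ+ → ℂ) (ω : Ω) :
    randomize X (z • a) ω = z • randomize X a ω :=
  funext fun _ => mul_assoc _ _ _

variable {p : ℝ≥0∞} [Fact (1 ≤ p)]

lemma coeffNorm_sub_le (b c : ℕ+ → ℂ) :
    coeffNorm p (b - c) ≤ coeffNorm p b + coeffNorm p c := by
  have h : b - c = b + (-1 : ℂ) • c := by simp [sub_eq_add_neg]
  rw [h]
  refine (coeffNorm_add_le _ _).trans (le_of_eq ?_)
  rw [coeffNorm_smul]
  simp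

/-! ### Random signs -/

/-- The sum of a series of square-summable sequences with signs from the torus. -/
def signSum (B : ℕ → Ell2) (w : Torus) : Ell2 := ∑' k, (w k : ℂ) • B k

lemma norm_coe_smul {E : Type*} [SeminormedAddCommGroup E] [NormedSpace ℂ E] (u : Circle) (x : E) :
    ‖(u : ℂ) • x‖ = ‖x‖ := by rw [norm_smul, Circle.norm_coe, one_mul]

lemma continuous_signSum {B : ℕ → Ell2} (hB : Summable fun k => ‖B k‖) :
    Continuous (signSum B) :=
  continuous_tsum (fun k => by fun_prop) hB fun k w => (norm_coe_smul _ _).le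

/-- Multiplying the `k`-th factor by `-1` leaves all other terms unchanged, so the difference
isolates `B k`. -/
lemma signSum_sub_flip {B : ℕ → Ell2} (hB : Summable fun k => ‖B k‖) (w : Torus) (k : ℕ) :
    signSum B w - signSum B (Pi.mulSingle k (-1) * w) = ((2 : ℂ) * w k) • B k := by
  have hs : ∀ v : Torus, Summable fun j => (v j : ℂ) • B j := fun v =>
    Summable.of_norm (by simpa only [norm_coe_smul] using hB)
  rw [signSum, signSum, ← (hs w).tsum_sub (hs _), tsum_eq_single k]
  · rw [Pi.mul_apply, Pi.mulSingle_eq_same, Circle.coe_mul, Circle.coe_neg, Circle.coe_one,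
      ← sub_smul]
    congr 1
    ring
  · intro j hj
    rw [Pi.mul_apply, Pi.mulSingle_eq_of_ne hj, one_mul, sub_self]

variable [MeasurableSpace Ω] {P : Measure Ω} [IsProbabilityMeasure P]

lemma measurable_coeffNorm_signSum (hX : ∀ n, Measurable (X n)) {B : ℕ → Ell2}
    (hB : Summable fun k => ‖B k‖) :
    Measurable fun q : Torus × Ω => coeffNorm p (randomize X (signSum B q.1) q.2) := by
  refine measurable_coeffNorm.comp (measurable_pi_lambda _ fun n => ?_)
  refine Measurable.mul ?_ (Complex.measurable_ofReal.comp ((hX n).comp measurable_snd))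
  exact ((continuous_coord n).comp (continuous_signSum hB)).measurable.comp measurable_fst

lemma measurable_coeffNorm_randomize (hX : ∀ n, Measurable (X n)) (a : ℕ+ → ℂ) :
    Measurable fun ω => coeffNorm p (randomize X a ω) :=
  measurable_coeffNorm.comp (measurable_pi_lambda _ fun n =>
    measurable_const.mul (Complex.measurable_ofReal.comp (hX n)))

/-- If all randomizations of a summable sequence with random signs are almost surely finite, then
its randomizations are bounded in probability. -/
lemma exists_bound_of_signSum (hX : ∀ n, Measurable (X n)) {B : ℕ → Ell2}
    (hB : Summable fun k => ‖B k‖)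
    (h : ∀ a : Ell2, ∀ᵐ ω ∂P, coeffNorm p (randomize X a ω) < ∞) :
    ∃ m : ℕ, ∀ k, P {ω | (m : ℝ≥0∞) < coeffNorm p (randomize X (B k) ω)} ≤ 1 / 4 := by
  set T : Torus × Ω → ℝ≥0∞ := fun q => coeffNorm p (randomize X (signSum B q.1) q.2) with hT
  have hTm : Measurable T := measurable_coeffNorm_signSum hX hB
  set μ := haarTorus.prod P with hμ
  -- Fubini: for each fixed `w` the sum is a single element of ℓ², to which the hypothesis applies.
  have htop : μ {q | T q = ∞} = 0 := by
    refine (Measure.measure_prod_null (hTm (measurableSet_singleton ∞))).2 ?_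
    refine Eventually.of_forall fun w => ?_
    have := h (signSum B w)
    rw [ae_iff] at this
    convert! this using 2
    ext ω
    simp [hT]
  -- The level `1/8` is half of the target `1/4`, since the event will be counted once before and
  -- once after the flip. The same `m` works for all `k`.
  obtain ⟨m, hm⟩ : ∃ m : ℕ, μ {q | (m : ℝ≥0∞) < T q} < 1 / 8 := by
    have hlim := tendsto_measure_iInter_atTop (μ := μ)
      (s := fun m : ℕ => {q | (m : ℝ≥0∞) < T q})
      (fun m => (measurableSet_lt measurable_const hTm).nullMeasurableSet)
      (fun i j hij q hq => lt_of_le_of_lt (Nat.cast_le.2 hij : (i : ℝ≥0∞) ≤ j) hq) ⟨0, measure_ne_top _ _⟩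
    have hzero : μ (⋂ m : ℕ, {q | (m : ℝ≥0∞) < T q}) = 0 := by
      refine measure_mono_null (fun q hq => ?_) htop
      by_contra hne
      obtain ⟨m, hm⟩ := ENNReal.exists_nat_gt hne
      exact lt_asymm hm (Set.mem_iInter.1 hq m)
    rw [hzero] at hlim
    exact (hlim.eventually (gt_mem_nhds (by norm_num))).exists
  refine ⟨m, fun k => ?_⟩
  set flip : Torus × Ω → Torus × Ω := Prod.map (fun w => Pi.mulSingle k (-1) * w) id with hflip
  have hfp : MeasurePreserving flip μ μ :=
    (measurePreserving_mul_left haarTorus _).prod (MeasurePreserving.id P)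
  have hsub : (Set.univ : Set Torus) ×ˢ {ω | (m : ℝ≥0∞) < coeffNorm p (randomize X (B k) ω)}
      ⊆ {q | (m : ℝ≥0∞) < T q} ∪ flip ⁻¹' {q | (m : ℝ≥0∞) < T q} := by
    rintro ⟨w, ω⟩ ⟨-, hω⟩
    by_contra hcon
    simp only [Set.mem_union, Set.mem_preimage, Set.mem_ofPred_eq, not_or, not_lt] at hcon
    obtain ⟨h1, h2⟩ := hcon
    -- If both sums have norm at most `m`, then twice the norm of the randomized `B k` is at most `2
    -- m`.
    have h3 : coeffNorm p (randomize X (((2 : ℂ) * w k) • B k : Ell2) ω) ≤ m + m := by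
      rw [← signSum_sub_flip hB w k, lp.coeFn_sub, randomize_sub]
      exact (coeffNorm_sub_le _ _).trans (add_le_add h1 h2)
    rw [lp.coeFn_smul, randomize_smul, coeffNorm_smul] at h3
    have h4 : ‖(2 : ℂ) * w k‖ₑ = 2 := by
      rw [← ofReal_norm, norm_mul, Circle.norm_coe]
      simp
    rw [h4, ← two_mul] at h3
    exact absurd ((ENNReal.mul_le_mul_iff_right (by simp) (by simp)).1 h3) (not_le.2 hω)
  calc P {ω | (m : ℝ≥0∞) < coeffNorm p (randomize X (B k) ω)}
      = μ (Set.univ ×ˢ {ω | (m : ℝ≥0∞) < coeffNorm p (randomize X (B k) ω)}) := by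
        rw [hμ, Measure.prod_prod, measure_univ, one_mul]
    _ ≤ μ {q | (m : ℝ≥0∞) < T q} + μ (flip ⁻¹' {q | (m : ℝ≥0∞) < T q}) :=
        (measure_mono hsub).trans (measure_union_le _ _)
    _ = μ {q | (m : ℝ≥0∞) < T q} + μ {q | (m : ℝ≥0∞) < T q} := by
        rw [hfp.measure_preimage (measurableSet_lt measurable_const hTm).nullMeasurableSet]
    _ ≤ 1 / 8 + 1 / 8 := add_le_add hm.le hm.le
    _ = 1 / 4 := by
        rw [← ENNReal.toReal_eq_toReal_iff' (by finiteness) (by finiteness)]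
        rw [ENNReal.toReal_add (by finiteness) (by finiteness)]
        norm_num

/-- If all randomizations are almost surely finite, then they are bounded in probability, uniformly
on the unit ball. -/
lemma exists_uniform_bound (hX : ∀ n, Measurable (X n))
    (h : ∀ a : Ell2, ∀ᵐ ω ∂P, coeffNorm p (randomize X a ω) < ∞) :
    ∃ K : ℝ, 0 < K ∧ ∀ a : Ell2,
      P {ω | ENNReal.ofReal (K * ‖a‖) < coeffNorm p (randomize X a ω)} ≤ 1 / 4 := by
  by_contra! hcon
  choose a ha using fun k : ℕ => hcon (4 ^ k) (by positivity)
  have hpos : ∀ k, 0 < ‖a k‖ := by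
    intro k
    by_contra h0
    have h0' : a k = 0 := norm_le_zero_iff.1 (not_lt.1 h0)
    have hz : ∀ ω, coeffNorm p (randomize X (a k) ω) = 0 := fun ω => by
      have := coeffNorm_smul (p := p) 0 (randomize X (a k) ω)
      rw [zero_smul, enorm_zero, zero_mul] at this
      rw [← this, h0']
      congr 1
      funext n
      simp [randomize]
    simpa [hz] using ha k
  -- This normalization gives `‖B k‖ = 2⁻ᵏ`, which is summable, while the threshold `4 ^ k * ‖a k‖`
  -- becomes `2 ^ k`, which is unbounded.
  let c : ℕ → ℝ := fun k => (2 ^ k * ‖a k‖)⁻¹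
  have hc : ∀ k, 0 < c k := fun k => inv_pos.2 (mul_pos (by positivity) (hpos k))
  let B : ℕ → Ell2 := fun k => (c k : ℂ) • a k
  have hB : Summable fun k => ‖B k‖ := by
    have : ∀ k, ‖B k‖ = (1 / 2 : ℝ) ^ k := fun k => by
      have := (hpos k).ne'
      rw [norm_smul, Complex.norm_real, Real.norm_of_nonneg (hc k).le]
      simp only [c]
      rw [one_div, inv_pow]
      field_simp
    simp_rw [this]
    exact summable_geometric_two
  obtain ⟨m, hm⟩ := exists_bound_of_signSum hX hB h
  obtain ⟨k, hk⟩ := pow_unbounded_of_one_lt (m : ℝ) one_lt_two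
  refine absurd (hm k) (not_le.2 ((ha k).trans_le (measure_mono fun ω hω => ?_)))
  have hω' : ENNReal.ofReal (4 ^ k * ‖a k‖) < coeffNorm p (randomize X (a k) ω) := hω
  change (m : ℝ≥0∞) < coeffNorm p (randomize X ((c k : ℂ) • a k : Ell2) ω)
  rw [lp.coeFn_smul, randomize_smul, coeffNorm_smul]
  have hce : ‖((c k : ℝ) : ℂ)‖ₑ = ENNReal.ofReal (c k) := by
    rw [← ofReal_norm, Complex.norm_real, Real.norm_of_nonneg (hc k).le]
  rw [hce]
  calc (m : ℝ≥0∞) = ENNReal.ofReal m := (ENNReal.ofReal_natCast m).symm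
    _ ≤ ENNReal.ofReal (2 ^ k) := ENNReal.ofReal_le_ofReal hk.le
    _ = ENNReal.ofReal (c k) * ENNReal.ofReal (4 ^ k * ‖a k‖) := by
        rw [← ENNReal.ofReal_mul (hc k).le]
        congr 1
        have := (hpos k).ne'
        have h4 : (4 : ℝ) ^ k = 2 ^ k * 2 ^ k := by rw [← mul_pow]; norm_num
        simp only [c]
        rw [h4]
        field_simp
    _ < _ := by
        have h0 : ENNReal.ofReal (c k) ≠ 0 := by simpa using hc k
        exact (ENNReal.mul_lt_mul_iff_right h0 ENNReal.ofReal_ne_top).2 hω'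

end

section

/-! ## Second moments of Gaussian vectors bounded in probability -/

/-- The constant in the comparison of the second moment of a centered Gaussian vector with a
quantile of its norm. -/
def gaussConst : ℝ≥0∞ :=
  (ENNReal.ofReal (Fernique.logRatio (3 / 4)))⁻¹ *
    (ENNReal.ofReal (Real.exp (Fernique.logRatio (3 / 4))) + ∑' n : ℕ, ENNReal.ofReal
      (Real.exp (-2⁻¹ * Real.log ((3 / 4 : ℝ≥0∞) / (1 - 3 / 4)).toReal * 2 ^ n)))

lemma half_lt_three_quarters : (2⁻¹ : ℝ≥0∞) < 3 / 4 := by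
  rw [← ENNReal.toReal_lt_toReal (by finiteness) (by finiteness)]
  norm_num

lemma three_quarters_lt_one : (3 / 4 : ℝ≥0∞) < 1 := by
  rw [← ENNReal.toReal_lt_toReal (by finiteness) (by finiteness)]
  norm_num

lemma logRatio_three_quarters_pos : 0 < Fernique.logRatio (3 / 4) :=
  Fernique.logRatio_pos half_lt_three_quarters three_quarters_lt_one

lemma toReal_odds : ((3 / 4 : ℝ≥0∞) / (1 - 3 / 4)).toReal = 3 := by
  rw [ENNReal.toReal_div, ENNReal.toReal_sub_of_le three_quarters_lt_one.le (by simp)]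
  norm_num

lemma gaussConst_ne_top : gaussConst ≠ ∞ := by
  refine ENNReal.mul_ne_top ?_ (ENNReal.add_ne_top.2 ⟨ENNReal.ofReal_ne_top, ?_⟩)
  · simpa using logRatio_three_quarters_pos
  · rw [toReal_odds]
    refine (Summable.tsum_ofReal_lt_top (Real.summable_exp_nat_mul_of_ge
      (c := -2⁻¹ * Real.log 3) ?_ fun i => mod_cast (Nat.lt_pow_self (by simp)).le)).ne
    exact mul_neg_of_neg_of_pos (by simp) (Real.log_pos (by norm_num))

/-- The second moment of a centered Gaussian measure is controlled by a quantile of the norm. -/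
lemma lintegral_sq_le_gaussConst {E : Type*} [NormedAddCommGroup E] [NormedSpace ℝ E]
    [MeasurableSpace E] [BorelSpace E] [CompleteSpace E] [SecondCountableTopology E]
    {μ : Measure E} [IsGaussian μ] (h0 : μ[id] = 0) {a : ℝ} (ha : 0 < a)
    (h : 3 / 4 ≤ μ {x | ‖x‖ ≤ a}) :
    ∫⁻ x, ‖x‖ₑ ^ 2 ∂μ ≤ gaussConst * ENNReal.ofReal a ^ 2 := by
  set c := Fernique.logRatio (3 / 4) with hc
  have hc0 : 0 < c := logRatio_three_quarters_pos
  -- Fernique's estimate: the product of a centered Gaussian measure with itself is invariant under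
  -- rotations, and the resulting bound depends only on the level `3/4`.
  have hexp := lintegral_exp_mul_sq_norm_le_of_map_rotation_eq_self
    (IsGaussian.map_rotation_eq_self h0 _) h half_lt_three_quarters
  have hpt : ∀ x : E, ‖x‖ₑ ^ 2 ≤ ((ENNReal.ofReal c)⁻¹ * ENNReal.ofReal a ^ 2) *
      ENNReal.ofReal (Real.exp (c * a⁻¹ ^ 2 * ‖x‖ ^ 2)) := by
    intro x
    rw [← ofReal_norm, ← ENNReal.ofReal_pow (norm_nonneg _), ← ENNReal.ofReal_pow ha.le,
      ← ENNReal.ofReal_inv_of_pos hc0, ← ENNReal.ofReal_mul (inv_nonneg.2 hc0.le),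
      ← ENNReal.ofReal_mul (by positivity)]
    refine ENNReal.ofReal_le_ofReal ?_
    have h1 : c * a⁻¹ ^ 2 * ‖x‖ ^ 2 ≤ Real.exp (c * a⁻¹ ^ 2 * ‖x‖ ^ 2) := by
      linarith [Real.add_one_le_exp (c * a⁻¹ ^ 2 * ‖x‖ ^ 2)]
    calc ‖x‖ ^ 2 = c⁻¹ * a ^ 2 * (c * a⁻¹ ^ 2 * ‖x‖ ^ 2) := by field_simp
      _ ≤ _ := by gcongr
  calc ∫⁻ x, ‖x‖ₑ ^ 2 ∂μ ≤ ∫⁻ x, ((ENNReal.ofReal c)⁻¹ * ENNReal.ofReal a ^ 2) *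
        ENNReal.ofReal (Real.exp (c * a⁻¹ ^ 2 * ‖x‖ ^ 2)) ∂μ := lintegral_mono hpt
    _ = ((ENNReal.ofReal c)⁻¹ * ENNReal.ofReal a ^ 2) *
        ∫⁻ x, ENNReal.ofReal (Real.exp (c * a⁻¹ ^ 2 * ‖x‖ ^ 2)) ∂μ :=
        lintegral_const_mul _ (by fun_prop)
    _ ≤ _ := mul_le_mul_right hexp _
    _ = gaussConst * ENNReal.ofReal a ^ 2 := by
        rw [gaussConst, mul_right_comm]

variable {Ω : Type*} {p : ℝ≥0∞} [Fact (1 ≤ p)] {X : ℕ+ → Ω → ℝ}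

lemma coeffNorm_randomize_ite (s : Finset ℕ+) (a : ℕ+ → ℂ) (ω : Ω) :
    coeffNorm p (randomize X (fun n => if n ∈ s then a n else 0) ω)
      = ‖partialSum p s (randomize X a ω)‖ₑ := by
  rw [← (hasMonomialExpansion_partialSum s (randomize X a ω)).coeffNorm_eq]
  congr 1
  funext n
  by_cases hn : n ∈ s <;> simp [randomize, hn]

lemma partialSum_randomize (s : Finset ℕ+) (a : ℕ+ → ℂ) (ω : Ω) :
    partialSum p s (randomize X a ω) = ∑ n ∈ s, X n ω • (a n • mono p n) := by
  refine Finset.sum_congr rfl fun n _ => ?_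
  rw [randomize, mul_comm, mul_smul]
  rfl

variable [MeasurableSpace Ω] {P : Measure Ω}

/-- The Gaussian estimate needs a complete, second countable space with its Borel structure, none of
which is assumed of `E`. The sum lives in the span of finitely many vectors, where all of this
holds. -/
lemma lintegral_sum_smul_sq_le {T : Type*} {X : T → Ω → ℝ} (hX : IsGaussianProcess X P)
    (hX0 : ∀ n, ∫ ω, X n ω ∂P = 0) {E : Type*} [NormedAddCommGroup E] [NormedSpace ℝ E]
    (s : Finset T) (v : T → E) {a : ℝ} (ha : 0 < a)
    (h : 3 / 4 ≤ P {ω | ‖∑ n ∈ s, X n ω • v n‖ ≤ a}) :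
    ∫⁻ ω, ‖∑ n ∈ s, X n ω • v n‖ₑ ^ 2 ∂P ≤ gaussConst * ENNReal.ofReal a ^ 2 := by
  let V : Submodule ℝ E := Submodule.span ℝ (Set.range fun i : s => v i)
  let : MeasurableSpace V := borel V
  have : BorelSpace V := ⟨rfl⟩
  have : FiniteDimensional ℝ V := FiniteDimensional.span_of_finite ℝ (Set.finite_range _)
  have : ProperSpace V := FiniteDimensional.proper ℝ V
  let u : s → V := fun i => ⟨v i, Submodule.subset_span ⟨i, rfl⟩⟩
  let L : (s → ℝ) →L[ℝ] V := ∑ i : s, (ContinuousLinearMap.proj i).smulRight (u i)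
  have hL : ∀ x, L x = ∑ i, x i • u i := fun x => by simp [L]
  have hLX : ∀ ω, ((L (s.restrict (X · ω)) : V) : E) = ∑ n ∈ s, X n ω • v n := by
    intro ω
    rw [hL, ← Finset.sum_coe_sort s]
    simp [u]
  have hG : HasGaussianLaw (fun ω => L (s.restrict (X · ω))) P := (hX.hasGaussianLaw s).map_fun L
  have hm := hG.aemeasurable
  have := hG.isGaussian_map
  have h0 : (P.map fun ω => L (s.restrict (X · ω)))[id] = 0 := by
    rw [integral_map hm (by fun_prop)]
    have hint : ∀ n, Integrable (X n) P := fun n => (hX.hasGaussianLaw_eval n).integrable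
    simp only [hL, id, Finset.restrict]
    rw [integral_finsetSum _ fun i _ => (hint i.1).smul_const (u i)]
    refine Finset.sum_eq_zero fun i _ => ?_
    have := integral_smul_const (μ := P) (X i) (u i)
    rw [hX0, zero_smul] at this
    exact this
  have hn : ∀ ω, ‖L (s.restrict (X · ω))‖ = ‖∑ n ∈ s, X n ω • v n‖ := fun ω => by
    rw [← hLX]; rfl
  have hen : ∀ ω, ‖∑ n ∈ s, X n ω • v n‖ₑ = ‖L (s.restrict (X · ω))‖ₑ := fun ω => by
    rw [← ofReal_norm, ← ofReal_norm, hn]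
  have key := lintegral_sq_le_gaussConst h0 ha (by
    rw [Measure.map_apply_of_aemeasurable hm (measurableSet_le measurable_norm measurable_const)]
    simpa only [Set.preimage_ofPred_eq, hn] using h)
  rw [lintegral_map' (by fun_prop) hm] at key
  simpa only [hen] using key

variable [IsProbabilityMeasure P]

/-- Polynomial randomizations are bounded in `L²`, uniformly on the unit ball. -/
lemma exists_lintegral_partialSum_sq_le (hm : ∀ n, Measurable (X n)) (hX : IsGaussianProcess X P)
    (hX0 : ∀ n, ∫ ω, X n ω ∂P = 0)
    (h : ∀ a : Ell2, ∀ᵐ ω ∂P, coeffNorm p (randomize X a ω) < ∞) :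
    ∃ C : ℝ, 0 ≤ C ∧ ∀ (s : Finset ℕ+) (a : ℕ+ → ℂ),
      ∫⁻ ω, ‖partialSum p s (randomize X a ω)‖ₑ ^ 2 ∂P
        ≤ ENNReal.ofReal (C * ∑ n ∈ s, ‖a n‖ ^ 2) := by
  obtain ⟨K, hK, hb⟩ := exists_uniform_bound hm h
  refine ⟨gaussConst.toReal * K ^ 2, by positivity, fun s a => ?_⟩
  have hsup : ∀ n ∉ s, ‖(if n ∈ s then a n else 0 : ℂ)‖ ^ 2 = 0 := fun n hn => by simp [hn]
  let b : Ell2 := ⟨fun n => if n ∈ s then a n else 0, memℓp_gen (by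
    simpa using summable_of_ne_finset_zero hsup)⟩
  have hbn : ‖b‖ ^ 2 = ∑ n ∈ s, ‖a n‖ ^ 2 := by
    rw [norm_sq_eq_tsum_coord]
    refine (tsum_eq_sum hsup).trans (Finset.sum_congr rfl fun n hn => ?_)
    simp [hn]
  have hbc : ∀ ω, coeffNorm p (randomize X b ω) = ‖partialSum p s (randomize X a ω)‖ₑ :=
    coeffNorm_randomize_ite s a
  -- The quantile in the Gaussian estimate must be positive, so the trivial case is separated.
  by_cases hb0 : ‖b‖ = 0
  · have hz : ∀ n ∈ s, a n = 0 := fun n hn => by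
      rw [hb0] at hbn
      have := (Finset.sum_eq_zero_iff_of_nonneg fun n _ => sq_nonneg ‖a n‖).1
        (hbn.symm.trans (by norm_num)) n hn
      simpa using this
    have hps : ∀ ω, partialSum p s (randomize X a ω) = 0 := fun ω =>
      Finset.sum_eq_zero fun n hn => by simp [randomize, hz n hn]
    simp [hps]
  · have hpos : 0 < K * ‖b‖ := mul_pos hK ((norm_nonneg b).lt_of_ne' hb0)
    have h34 : 3 / 4 ≤ P {ω | ‖∑ n ∈ s, X n ω • (a n • mono p n)‖ ≤ K * ‖b‖} := by
      have hset : {ω | ‖∑ n ∈ s, X n ω • (a n • mono p n)‖ ≤ K * ‖b‖}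
          = {ω | ENNReal.ofReal (K * ‖b‖) < coeffNorm p (randomize X b ω)}ᶜ := by
        ext ω
        simp only [Set.mem_ofPred_eq, Set.mem_compl_iff, not_lt]
        rw [hbc, partialSum_randomize, ← ofReal_norm, ENNReal.ofReal_le_ofReal_iff hpos.le]
      rw [hset, measure_compl (measurableSet_lt measurable_const
        (measurable_coeffNorm_randomize hm b)) (measure_ne_top _ _), measure_univ]
      have h1 : (3 / 4 : ℝ≥0∞) = 1 - 1 / 4 := by
        rw [← ENNReal.toReal_eq_toReal_iff' (by finiteness) (by finiteness),
          ENNReal.toReal_sub_of_le _ (by simp)]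
        · norm_num
        · rw [← ENNReal.toReal_le_toReal (by finiteness) (by finiteness)]
          norm_num
      rw [h1]
      exact tsub_le_tsub_left (hb b) 1
    have key := lintegral_sum_smul_sq_le hX hX0 s (fun n => a n • mono p n) hpos h34
    simp_rw [partialSum_randomize]
    refine key.trans (le_of_eq ?_)
    rw [← hbn, mul_assoc, ← mul_pow, ENNReal.ofReal_mul ENNReal.toReal_nonneg,
      ENNReal.ofReal_toReal gaussConst_ne_top, ENNReal.ofReal_pow hpos.le]

end

section

/-! ## The randomization operator -/

variable {Ω : Type*} {p : ℝ≥0∞} [Fact (1 ≤ p)] {X : ℕ+ → Ω → ℝ}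

lemma partialSum_sub_of_subset {s t : Finset ℕ+} (h : t ⊆ s) (b : ℕ+ → ℂ) :
    partialSum p s b - partialSum p t b = partialSum p (s \ t) b :=
  (Finset.sum_sdiff_eq_sub h).symm

lemma HasMonomialExpansion.enorm_sub_sq_le_liminf {G : Hardy p} {b : ℕ+ → ℂ}
    (h : HasMonomialExpansion G b) (H : Hardy p) :
    ‖G - H‖ₑ ^ 2 ≤ liminf (fun M => ‖partialSum p (initial M) b - H‖ₑ ^ 2) atTop := by
  have hmono : Monotone fun x : ℝ≥0∞ => x ^ 2 := fun x y hxy => pow_le_pow_left' hxy 2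
  have hmap := hmono.map_liminf_of_continuousAt (F := atTop)
    (fun M => ‖partialSum p (initial M) b - H‖ₑ) (ENNReal.continuous_pow 2).continuousAt
  exact (hmono (h.enorm_sub_le_liminf H)).trans hmap.le

variable [MeasurableSpace Ω] {P : Measure Ω}

lemma stronglyMeasurable_partialSum (hm : ∀ n, Measurable (X n)) (s : Finset ℕ+) (a : ℕ+ → ℂ) :
    StronglyMeasurable fun ω => partialSum p s (randomize X a ω) := by
  simp_rw [partialSum_randomize]
  exact Finset.stronglyMeasurable_fun_sum _ fun n _ => (hm n).stronglyMeasurable.smul_const _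

/-- If the partial sums of randomizations are bounded in `L²`, their remainders tend to zero. -/
lemma lintegral_liminf_sq_le {C : ℝ} (hC : 0 ≤ C) (hm : ∀ n, Measurable (X n))
    (hb : ∀ (s : Finset ℕ+) (a : ℕ+ → ℂ), ∫⁻ ω, ‖partialSum p s (randomize X a ω)‖ₑ ^ 2 ∂P
      ≤ ENNReal.ofReal (C * ∑ n ∈ s, ‖a n‖ ^ 2))
    {a : ℕ+ → ℂ} (ha : Summable fun n => ‖a n‖ ^ 2) (t : Finset ℕ+) :
    ∫⁻ ω, liminf (fun M => ‖partialSum p (initial M) (randomize X a ω)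
        - partialSum p t (randomize X a ω)‖ₑ ^ 2) atTop ∂P
      ≤ ENNReal.ofReal (C * (∑' n, ‖a n‖ ^ 2 - ∑ n ∈ t, ‖a n‖ ^ 2)) := by
  refine (lintegral_liminf_le fun M => ?_).trans ?_
  · exact (((stronglyMeasurable_partialSum hm _ a).sub
      (stronglyMeasurable_partialSum hm t a)).enorm).pow_const 2
  · refine liminf_le_of_frequently_le' (Eventually.frequently ?_)
    -- Once the partial sum contains `t`, the difference is a polynomial randomization over the
    -- complementary indices, and the uniform bound applies to it.
    filter_upwards [tendsto_initial.eventually (eventually_ge_atTop t)] with M hM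
    simp_rw [partialSum_sub_of_subset hM]
    refine (hb _ a).trans (ENNReal.ofReal_le_ofReal ?_)
    gcongr
    rw [Finset.sum_sdiff_eq_sub hM]
    exact sub_le_sub_right (ha.sum_le_tsum _ fun _ _ => sq_nonneg _) _

lemma tendsto_of_enorm_sub_sq {E : Type*} [NormedAddCommGroup E] {f : ℕ → E} {x : E}
    (h : Tendsto (fun k => ‖x - f k‖ₑ ^ 2) atTop (𝓝 0)) : Tendsto f atTop (𝓝 x) := by
  have h1 := ((ENNReal.continuous_rpow_const (y := 1 / 2)).tendsto 0).comp h
  rw [tendsto_iff_edist_tendsto_0]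
  have h2 : ∀ k, edist (f k) x = (‖x - f k‖ₑ ^ 2) ^ (1 / 2 : ℝ) := fun k => by
    rw [edist_comm, edist_eq_enorm_sub, ← ENNReal.rpow_natCast, ← ENNReal.rpow_mul]
    norm_num
  simp_rw [h2]
  simpa [Function.comp_def] using h1

/-- A randomization with values in a Hardy space is strongly measurable: it is an almost sure limit
of polynomial randomizations. -/
lemma aestronglyMeasurable_randomization {C : ℝ} (hC : 0 ≤ C) (hm : ∀ n, Measurable (X n))
    (hb : ∀ (s : Finset ℕ+) (a : ℕ+ → ℂ), ∫⁻ ω, ‖partialSum p s (randomize X a ω)‖ₑ ^ 2 ∂P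
      ≤ ENNReal.ofReal (C * ∑ n ∈ s, ‖a n‖ ^ 2))
    {a : ℕ+ → ℂ} (ha : Summable fun n => ‖a n‖ ^ 2) {G : Ω → Hardy p}
    (hG : ∀ᵐ ω ∂P, HasMonomialExpansion (G ω) (randomize X a ω)) :
    AEStronglyMeasurable G P := by
  have htail : Tendsto (fun M => C * (∑' n, ‖a n‖ ^ 2 - ∑ n ∈ initial M, ‖a n‖ ^ 2)) atTop
      (𝓝 0) := by
    have h1 : Tendsto (fun M => ∑ n ∈ initial M, ‖a n‖ ^ 2) atTop (𝓝 (∑' n, ‖a n‖ ^ 2)) :=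
      ha.hasSum.comp tendsto_initial
    have h2 := (h1.const_sub (∑' n, ‖a n‖ ^ 2)).const_mul C
    rwa [sub_self, mul_zero] at h2
  -- A subsequence whose remainders have expected squared size below `2⁻ᵏ`; the sum over `k` is
  -- finite, so almost surely the remainders tend to zero.
  choose φ hφ using fun k : ℕ =>
    (htail.eventually (gt_mem_nhds (pow_pos (one_half_pos (α := ℝ)) k))).exists
  -- Dominates the squared distance from `G` to the `k`-th polynomial, and is measurable before
  -- anything is known about the measurability of `G`.
  let D : ℕ → Ω → ℝ≥0∞ := fun k ω => liminf (fun M => ‖partialSum p (initial M) (randomize X a ω)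
    - partialSum p (initial (φ k)) (randomize X a ω)‖ₑ ^ 2) atTop
  have hDm : ∀ k, Measurable (D k) := fun k => Measurable.liminf fun M =>
    (((stronglyMeasurable_partialSum hm _ a).sub
      (stronglyMeasurable_partialSum hm _ a)).enorm).pow_const 2
  have hD : ∫⁻ ω, ∑' k, D k ω ∂P ≠ ∞ := by
    rw [lintegral_tsum fun k => (hDm k).aemeasurable]
    refine ((ENNReal.tsum_le_tsum fun k => (lintegral_liminf_sq_le hC hm hb ha _).trans
      (ENNReal.ofReal_le_ofReal (hφ k).le)).trans_lt ?_).ne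
    exact summable_geometric_two.tsum_ofReal_lt_top
  have hDae := ae_lt_top (Measurable.tsum hDm) hD
  refine aestronglyMeasurable_of_tendsto_ae atTop
    (f := fun k ω => partialSum p (initial (φ k)) (randomize X a ω))
    (fun k => (stronglyMeasurable_partialSum hm _ a).aestronglyMeasurable) ?_
  filter_upwards [hDae, hG] with ω h1 h2
  refine tendsto_of_enorm_sub_sq (tendsto_of_tendsto_of_tendsto_of_le_of_le tendsto_const_nhds
    (ENNReal.tendsto_atTop_zero_of_tsum_ne_top h1.ne) (fun _ => zero_le) fun k => ?_)
  exact h2.enorm_sub_sq_le_liminf _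

/-- The remainder estimate with `t = ∅`, where the remainder is the whole series. -/
lemma eLpNorm_randomization_le {C : ℝ} (hC : 0 ≤ C) (hm : ∀ n, Measurable (X n))
    (hb : ∀ (s : Finset ℕ+) (a : ℕ+ → ℂ), ∫⁻ ω, ‖partialSum p s (randomize X a ω)‖ₑ ^ 2 ∂P
      ≤ ENNReal.ofReal (C * ∑ n ∈ s, ‖a n‖ ^ 2))
    {a : ℕ+ → ℂ} (ha : Summable fun n => ‖a n‖ ^ 2) {G : Ω → Hardy p}
    (hG : ∀ᵐ ω ∂P, HasMonomialExpansion (G ω) (randomize X a ω)) :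
    eLpNorm G 2 P ≤ ENNReal.ofReal √(C * ∑' n, ‖a n‖ ^ 2) := by
  have h1 : ∫⁻ ω, ‖G ω‖ₑ ^ 2 ∂P ≤ ENNReal.ofReal (C * ∑' n, ‖a n‖ ^ 2) := by
    have h2 := lintegral_liminf_sq_le hC hm hb ha ∅
    rw [Finset.sum_empty, sub_zero] at h2
    refine le_trans (lintegral_mono_ae ?_) h2
    filter_upwards [hG] with ω hω
    simpa [partialSum] using hω.enorm_sub_sq_le_liminf (partialSum p ∅ (randomize X a ω))
  rw [eLpNorm_eq_lintegral_rpow_enorm_toReal (by simp) (by simp)]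
  simp only [ENNReal.toReal_ofNat, ENNReal.rpow_ofNat]
  rw [Real.sqrt_eq_rpow, ← ENNReal.ofReal_rpow_of_nonneg
    (mul_nonneg hC (tsum_nonneg fun _ => sq_nonneg _)) (by norm_num)]
  exact ENNReal.rpow_le_rpow h1 (by norm_num)

variable [IsProbabilityMeasure P]

lemma exists_randomization_of_measurable (hm : ∀ n, Measurable (X n)) (hX : IsGaussianProcess X P)
    (hX0 : ∀ n, ∫ ω, X n ω ∂P = 0)
    (hR : ∀ (F : Hardy 2) (a : ℕ+ → ℂ), HasMonomialExpansion F a →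
      ∀ᵐ ω ∂P, ∃ G : Hardy p, HasMonomialExpansion G (randomize X a ω)) :
    ∃ R : Hardy 2 →L[ℂ] Lp (Hardy p) 2 P, ∀ F : Hardy 2,
      ∀ a : ℕ+ → ℂ, HasMonomialExpansion F a →
        ∀ᵐ ω ∂P, HasMonomialExpansion (R F ω) (randomize X a ω) := by
  obtain ⟨C, hC, hb⟩ := exists_lintegral_partialSum_sq_le (p := p) hm hX hX0 fun a => by
    obtain ⟨F, hF⟩ := exists_hardy_two (summable_sq_coord a)
    filter_upwards [hR F a hF] with ω ⟨G, hG⟩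
    rw [hG.coeffNorm_eq]
    exact enorm_lt_top
  choose A hA using exists_hasMonomialExpansion
  have hsum : ∀ F, Summable fun n => ‖A F n‖ ^ 2 := fun F =>
    summable_of_sum_le (fun _ => sq_nonneg _) (hA F).sum_sq_le
  -- The sum is selected for each `ω` with no regard to measurability, which is recovered from the
  -- almost sure approximation by polynomials.
  choose G hG using fun F => (hR F (A F) (hA F)).choice
  have hmeas : ∀ F, AEStronglyMeasurable (G F) P := fun F =>
    aestronglyMeasurable_randomization hC hm hb (hsum F) (hG F)
  have hnorm : ∀ F, eLpNorm (G F) 2 P ≤ ENNReal.ofReal (√C * ‖F‖) := fun F => by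
    refine (eLpNorm_randomization_le hC hm hb (hsum F) (hG F)).trans (ENNReal.ofReal_le_ofReal ?_)
    rw [Real.sqrt_mul hC]
    gcongr
    exact Real.sqrt_le_iff.2 ⟨norm_nonneg _,
      (hsum F).tsum_le_of_sum_le (hA F).sum_sq_le⟩
  have hmem : ∀ F, MemLp (G F) 2 P := fun F =>
    ⟨hmeas F, (hnorm F).trans_lt ENNReal.ofReal_lt_top⟩
  let R₀ : Hardy 2 →ₗ[ℂ] Lp (Hardy p) 2 P :=
    { toFun := fun F => (hmem F).toLp (G F)
      map_add' := fun F H => by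
        rw [← MemLp.toLp_add]
        refine MemLp.toLp_congr _ _ ?_
        -- Linearity follows from uniqueness: coefficients are determined by the function, and the
        -- randomized function by its coefficients.
        have hc : A (F + H) = A F + A H :=
          (hA (F + H)).coeff_unique (F + H).2.1 ((hA F).add (hA H))
        filter_upwards [hG (F + H), hG F, hG H] with ω h1 h2 h3
        rw [hc, randomize_add] at h1
        exact Subtype.ext (h1.unique (h2.add h3))
      map_smul' := fun c F => by
        rw [RingHom.id_apply, ← MemLp.toLp_const_smul]
        refine MemLp.toLp_congr _ _ ?_
        have hc : A (c • F) = c • A F := (hA (c • F)).coeff_unique (c • F).2.1 ((hA F).smul c)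
        filter_upwards [hG (c • F), hG F] with ω h1 h2
        rw [hc, randomize_smul] at h1
        exact Subtype.ext (h1.unique (h2.smul c)) }
  refine ⟨R₀.mkContinuous √C fun F => ?_, fun F a ha => ?_⟩
  · change ‖(hmem F).toLp (G F)‖ ≤ _
    rw [Lp.norm_toLp]
    exact ENNReal.toReal_le_of_le_ofReal (by positivity) (hnorm F)
  · have hc : a = A F := ha.coeff_unique F.2.1 (hA F)
    filter_upwards [(hmem F).coeFn_toLp, hG F] with ω h1 h2
    change HasMonomialExpansion ((hmem F).toLp (G F) ω) _
    rw [h1, hc]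
    exact h2

end

end

end InfHardy

theorem theorem3p3 {Ω : Type*} [MeasurableSpace Ω] (P : Measure Ω) [IsProbabilityMeasure P]
    (p : ℝ≥0∞) [Fact (1 ≤ p)] (hp : p ≠ ∞)
    (X : ℕ+ → Ω → ℝ) (hX : IsGaussianProcess X P) (hX0 : ∀ n, ∫ ω, X n ω ∂P = 0)
    (hR : ∀ (F : Hardy 2) (a : ℕ+ → ℂ), HasMonomialExpansion F a →
      ∀ᵐ ω ∂P, ∃ G : Hardy p, HasMonomialExpansion G (fun n => a n * (X n ω : ℂ))) :
    ∃ R : Hardy 2 →L[ℂ] Lp (Hardy p) 2 P, ∀ F : Hardy 2,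
      (∃ a : ℕ+ → ℂ, HasMonomialExpansion F a) ∧
      ∀ a : ℕ+ → ℂ, HasMonomialExpansion F a →
        ∀ᵐ ω ∂P, HasMonomialExpansion (R F ω) (fun n => a n * (X n ω : ℂ)) := by
  -- The members of a Gaussian process are only almost everywhere measurable. As there are countably
  -- many, measurable versions agree with all of them simultaneously outside a null set.
  let Y : ℕ+ → Ω → ℝ := fun n => (hX.aemeasurable n).mk (X n)
  have hXY : ∀ n, X n =ᵐ[P] Y n := fun n => (hX.aemeasurable n).ae_eq_mk
  have hall : ∀ᵐ ω ∂P, ∀ n, X n ω = Y n ω := ae_all_iff.2 hXY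
  obtain ⟨R, hRY⟩ := exists_randomization_of_measurable (p := p) (X := Y) (P := P)
    (fun n => (hX.aemeasurable n).measurable_mk) (hX.congr hXY)
    (fun n => (integral_congr_ae (hXY n)).symm.trans (hX0 n)) fun F a ha => by
      filter_upwards [hR F a ha, hall] with ω h1 h2
      simp only [h2] at h1
      exact h1
  refine ⟨R, fun F => ⟨exists_hasMonomialExpansion F, fun a ha => ?_⟩⟩
  filter_upwards [hRY F a ha, hall] with ω h1 h2
  simp only [h2]
  exact h1
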